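/- For positive integers $s_1,\dots,s_r$ with $s_1>1$ let $$\zeta^\star(s_1,\dots,s_r)=\sum_{k_1\ge\cdots\ge k_r\ge 1}\frac{1}{k_1^{s_1}\cdots k_r^{s_r}},\qquad \zeta^\star(\emptyset)=1,$$ and let $\{2\}^a$ denote the string $2,\dots,2$ of length $a$. For integers $d\ge 0$, $n\ge 0$ put $$Z_0^\star(d,n)=\sum_{\substack{a_1,\dots,a_{2d}\ge 0\\ a_1+\cdots+a_{2d}=n}}\zeta^\star(\{2\}^{a_1},3,\{2\}^{a_2},1,\dots,3,\{2\}^{a_{2d}},1),$$ and for $d\ge 0$, $n\ge 1$ $$Z_1^\star(d,n)=\sum_{\substack{a_1,\dots,a_{2d+1}\ge 0\\ a_1+\cdots+a_{2d+1}=n-1}}\zeta^\star(\{2\}^{a_1},3,\{2\}^{a_2},1,\dots,3,\{2\}^{a_{2d}},1,\{2\}^{a_{2d+1}+1}).$$ Let $z,w\in\mathbb{C}$ with $|z|<1$ and $|w|<1$. Then for every $d\ge 0$ the inner series (over $n$) below converge absolutely. If moreover $|w|^2<|1-z^2|$, then the two outer series (over $d$) converge absolutely as well, and $$\sum_{d=0}^{\infty}\sum_{n=0}^{\infty}Z_0^\star(d,n)\,z^{2n}w^{4d}-\sum_{d=0}^{\infty}\sum_{n=1}^{\infty}Z_1^\star(d,n)\,z^{2n-2}w^{4d+2}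 =\frac{\sqrt{z^2+w^2}}{\sqrt{z^2-w^2}}\,\tan\!\left(\frac{\pi\sqrt{z^2-w^2}}{2}\right)\cot\!\left(\frac{\pi\sqrt{z^2+w^2}}{2}\right).$$ Here the choice of the square roots is irrelevant, and the right-hand side is understood as its continuous extension where $z^2=w^2$ or $z^2=-w^2$: $\tan(\pi a/2)/a$ is read as $\pi/2$ at $a=0$, and $b\cot(\pi b/2)$ as $2/\pi$ at $b=0$. -/

import Mathlib

/-- The multiple zeta star value `ζ⋆(s₁, …, s_r)`: the sum of `k₁^(-s₁) ⋯ k_r^(-s_r)` over all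
positive integers `k₁ ≥ ⋯ ≥ k_r ≥ 1`. The empty index has value `1`. -/
noncomputable def zetaStar (s : List ℕ) : ℝ :=
  ∑' k : {k : Fin s.length → ℕ+ // Antitone k},
    ∏ i, (1 : ℝ) / ((k.1 i : ℕ) : ℝ) ^ (s.get i)

/-- The index `({2}^{a₁}, 3, {2}^{a₂}, 1, …, 3, {2}^{a_{2d}}, 1)`. -/
def index31 (d : ℕ) (a : Fin (2 * d) → ℕ) : List ℕ :=
  (List.ofFn fun j : Fin (2 * d) =>
    List.replicate (a j) 2 ++ [if (j : ℕ) % 2 = 0 then 3 else 1]).flatten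

/-- `Z⋆₀(d, n)`: the sum of `ζ⋆({2}^{a₁}, 3, {2}^{a₂}, 1, …, 3, {2}^{a_{2d}}, 1)` over
`a₁ + ⋯ + a_{2d} = n`. -/
noncomputable def Zstar0 (d n : ℕ) : ℝ :=
  ∑ a ∈ Finset.Nat.antidiagonalTuple (2 * d) n, zetaStar (index31 d a)

/-- `Z⋆₁(d, n)`: the sum of
`ζ⋆({2}^{a₁}, 3, {2}^{a₂}, 1, …, 3, {2}^{a_{2d}}, 1, {2}^{a_{2d+1} + 1})` over
`a₁ + ⋯ + a_{2d+1} = n - 1` (an empty sum for `n = 0`). -/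
noncomputable def Zstar1 (d : ℕ) : ℕ → ℝ
  | 0 => 0
  | n + 1 => ∑ a ∈ Finset.Nat.antidiagonalTuple (2 * d + 1) n,
      zetaStar (index31 d (fun j => a j.castSucc) ++ List.replicate (a (Fin.last (2 * d)) + 1) 2)

/-- `tan (π a / 2) / a`, extended by its limit `π / 2` at `a = 0`. -/
noncomputable def tanQuot (a : ℂ) : ℂ :=
  if a = 0 then (Real.pi : ℂ) / 2 else Complex.tan (Real.pi * a / 2) / a

/-- `b * cot (π b / 2)`, extended by its limit `2 / π` at `b = 0`. -/
noncomputable def cotProd (b : ℂ) : ℂ :=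
  if b = 0 then 2 / (Real.pi : ℂ) else b * Complex.cot (Real.pi * b / 2)

/-! Put `Z = z²` and `W = w²`. Cut every star sum at `k₁ ≤ N` and form generating functions in `Z`
and `W`, admitting also strings with an odd number of letters `3`, `1`. Splitting off the terms with
`k₁ = N + 1` removes the leading letter, so the even function `E_N` and the odd function `O_N`
satisfy a linear first-order system in `N`, whose step is invertible for the parameters used.

This system has an explicit solution. Let `r_k` be the partial products of `∏ (k² - Z + (-1)^k W) /
(k² - Z - (-1)^k W)` and let `c(N,k) = N!²/((N-k)!(N+k)!)`. Then `E_N = r_0 + ∑ (r_k - r_{k-1})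
c(N,k)`, and `O_N` is `N` times the same transform of `(-1)^k r_k`. The reason is that `N² (c(N,k) -
c(N-1,k)) = k² c(N,k)`: the transform turns the difference operator in `N` into multiplication by
`k²`, and the system becomes the two-term recursion of `r` (`connectorSum_altProd_rec`,
`mul_connectorSum_altProd_rec`, `evenGen_eq_connectorSum`). Since `c(N,k) → 1`, the sum telescopes
in the limit to `lim r_k`. Separating odd and even `k` gives Euler's products for cosine and sine at
`a² = Z - W` and `b² = Z + W`, hence the tangent and cotangent (`altProdLim_eq`).

Convergence comes from the same solution. For real `r, t ≥ 0` with `r + t < 1`, finite partial sums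
of the generating functions are subsolutions of the system at `(Z, W) = (r, -t)`, so they stay below
the explicit solution, which is bounded in the even case (`sum_mixSum_le_connectorSum`). This bounds
all truncations at once, makes the star values limits of their truncations, and dominates the
complex series for `|Z| + |W| < 1`. The larger range `|W| < |1 - Z|` follows because the product is
holomorphic in `W` on that disc, so its Taylor series, identified near `0`, converges to it there
(`hasSum_genCoeff`). -/

/-! ### Truncated star sums and their limits -/

/-- The truncated multiple zeta star sum: the terms of `ζ⋆(s₁, …, s_r)` with `k₁ ≤ n`. -/
noncomputable def starSum : List ℕ → ℕ → ℝ
  | [], _ => 1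
  | s :: l, n => ∑ k ∈ Finset.range n, starSum l (k + 1) / ((k : ℝ) + 1) ^ s

theorem starSum_nil (n : ℕ) : starSum [] n = 1 := by simp [starSum]

theorem starSum_cons (s : ℕ) (l : List ℕ) (n : ℕ) :
    starSum (s :: l) n = ∑ k ∈ Finset.range n, starSum l (k + 1) / ((k : ℝ) + 1) ^ s := by
  rw [starSum]

theorem starSum_cons_zero (s : ℕ) (l : List ℕ) : starSum (s :: l) 0 = 0 := by
  simp [starSum_cons]

theorem starSum_cons_succ (s : ℕ) (l : List ℕ) (n : ℕ) :
    starSum (s :: l) (n + 1) = starSum (s :: l) n + starSum l (n + 1) / ((n : ℝ) + 1) ^ s := by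
  simp [starSum_cons, Finset.sum_range_succ]

theorem starSum_nonneg (l : List ℕ) (n : ℕ) : 0 ≤ starSum l n := by
  induction l generalizing n with
  | nil => simp [starSum_nil]
  | cons s l ih =>
    rw [starSum_cons]
    exact Finset.sum_nonneg fun k _ => div_nonneg (ih _) (by positivity)

/-- The sum defining `ζ⋆(s)` with all `k_i` in `Q`, as an extended nonnegative real. -/
noncomputable def starTsum (s : List ℕ) (Q : Set ℕ+) : ENNReal := by
  classical
  exact ∑' k : Fin s.length → ℕ+, if Antitone k ∧ ∀ i, k i ∈ Q then
    ∏ i, ENNReal.ofReal (1 / ((k i : ℕ) : ℝ) ^ s.get i) else 0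

theorem antitone_fin_cons_iff {n : ℕ} (m : ℕ+) (k : Fin n → ℕ+) :
    Antitone (Fin.cons m k : Fin (n + 1) → ℕ+) ↔ Antitone k ∧ ∀ i, k i ≤ m := by
  constructor
  · intro h
    refine ⟨fun i j hij => ?_, fun i => ?_⟩
    · simpa using h (Fin.succ_le_succ_iff.mpr hij)
    · simpa using h (Fin.zero_le i.succ)
  · rintro ⟨h1, h2⟩ i j
    refine Fin.cases ?_ (fun i => ?_) i <;> refine Fin.cases ?_ (fun j => ?_) j
    · simp
    · intro _; simpa using h2 j
    · intro h; exact absurd h (by simp)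
    · intro h; simpa using h1 (Fin.succ_le_succ_iff.mp h)

-- In `ENNReal` the outermost variable splits off without any summability hypothesis. As `Q` is a
-- lower set, membership of the inner variables follows from their being at most `m`.
open Classical in
theorem starTsum_cons (s : ℕ) (l : List ℕ) {Q : Set ℕ+} (hQ : IsLowerSet Q) :
    starTsum (s :: l) Q = ∑' m : ℕ+, if m ∈ Q then
      ENNReal.ofReal (1 / ((m : ℕ) : ℝ) ^ s) * starTsum l (Set.Iic m) else 0 := by
  unfold starTsum
  refine ((Fin.consEquiv (n := l.length) (fun _ => ℕ+)).tsum_eq _).symm.trans ?_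
  have := ENNReal.tsum_prod (f := fun (m : ℕ+) (k : Fin l.length → ℕ+) =>
    if Antitone (Fin.cons m k : Fin (l.length + 1) → ℕ+) ∧
      ∀ i, (Fin.cons m k : Fin (l.length + 1) → ℕ+) i ∈ Q then
    ∏ i, ENNReal.ofReal (1 / (((Fin.cons m k : Fin (l.length + 1) → ℕ+) i : ℕ) : ℝ) ^
      (s :: l).get i) else 0)
  refine Eq.trans this ?_
  refine tsum_congr fun m => ?_
  split_ifs with hm
  · rw [← ENNReal.tsum_mul_left]
    refine tsum_congr fun k => ?_
    have : (Antitone (Fin.cons m k : Fin (l.length + 1) → ℕ+) ∧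
        ∀ i, (Fin.cons m k : Fin (l.length + 1) → ℕ+) i ∈ Q) ↔
        (Antitone k ∧ ∀ i, k i ∈ Set.Iic m) := by
      rw [antitone_fin_cons_iff]
      constructor
      · exact fun h => h.1
      · refine fun h => ⟨h, fun i => ?_⟩
        refine Fin.cases ?_ (fun i => ?_) i
        · simpa using hm
        · simpa using hQ (h.2 i) hm
    by_cases hc : Antitone k ∧ ∀ i, k i ∈ Set.Iic m
    · rw [if_pos (this.mpr hc), if_pos hc]
      exact Fin.prod_univ_succ _
    · rw [if_neg (mt this.mp hc), if_neg hc, mul_zero]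
  · refine ENNReal.tsum_eq_zero.mpr fun k => if_neg fun h => hm ?_
    simpa using h.2 0

theorem ofReal_one_div_mul_ofReal (s k : ℕ) (x : ℝ) :
    ENNReal.ofReal (1 / (((k.succPNat : ℕ+) : ℕ) : ℝ) ^ s) * ENNReal.ofReal x =
      ENNReal.ofReal (x / ((k : ℝ) + 1) ^ s) := by
  rw [← ENNReal.ofReal_mul (by positivity)]
  congr 1
  simp [div_eq_mul_inv, mul_comm]

theorem starTsum_Iic (l : List ℕ) (n : ℕ) :
    starTsum l {m : ℕ+ | (m : ℕ) ≤ n} = ENNReal.ofReal (starSum l n) := by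
  induction l generalizing n with
  | nil =>
    have : Unique (Fin ([] : List ℕ).length → ℕ+) :=
      { default := fun i => i.elim0, uniq := fun a => funext fun i => i.elim0 }
    rw [starSum_nil, starTsum, tsum_fintype, Fintype.sum_unique]
    rw [if_pos ⟨fun i => i.elim0, fun i => i.elim0⟩]
    simp
  | cons s l ih =>
    have hQ : IsLowerSet {m : ℕ+ | (m : ℕ) ≤ n} :=
      fun a b hba ha => le_trans (PNat.coe_le_coe b a |>.mpr hba) ha
    rw [starTsum_cons s l hQ, starSum_cons,
      ENNReal.ofReal_sum_of_nonneg
        (fun k _ => div_nonneg (starSum_nonneg _ _) (by positivity)),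
      ← Equiv.pnatEquivNat.symm.tsum_eq, tsum_eq_sum (s := Finset.range n)]
    · refine Finset.sum_congr rfl fun k hk => ?_
      have hk' : k + 1 ≤ n := Finset.mem_range.mp hk
      have h2 : (Set.Iic (Equiv.pnatEquivNat.symm k) : Set ℕ+) = {m : ℕ+ | (m : ℕ) ≤ k + 1} := by
        ext m
        simp [Equiv.pnatEquivNat, ← PNat.coe_le_coe]
      rw [if_pos (by simpa [Equiv.pnatEquivNat] using hk'), h2, ih]
      exact ofReal_one_div_mul_ofReal s k _
    · intro k hk
      have hk' : ¬ k + 1 ≤ n := by simpa using hk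
      exact if_neg (by simpa [Equiv.pnatEquivNat] using hk')

theorem zetaStar_eq_toReal (l : List ℕ) : zetaStar l = (starTsum l Set.univ).toReal := by
  classical
  have h1 : starTsum l Set.univ = ∑' k : {k : Fin l.length → ℕ+ // Antitone k},
      ∏ i, ENNReal.ofReal (1 / ((k.1 i : ℕ) : ℝ) ^ l.get i) := by
    have := tsum_subtype {k : Fin l.length → ℕ+ | Antitone k}
      (fun k => ∏ i, ENNReal.ofReal (1 / ((k i : ℕ) : ℝ) ^ l.get i))
    refine Eq.trans ?_ this.symm
    unfold starTsum
    refine tsum_congr fun k => ?_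
    simp [Set.indicator_apply]
  rw [h1, ENNReal.tsum_toReal_eq
    (fun k => ENNReal.prod_ne_top fun i _ => ENNReal.ofReal_ne_top), zetaStar]
  refine tsum_congr fun k => ?_
  rw [ENNReal.toReal_prod]
  exact Finset.prod_congr rfl fun i _ => (ENNReal.toReal_ofReal (by positivity)).symm

theorem zetaStar_nil : zetaStar [] = 1 := by
  have : Unique {k : Fin ([] : List ℕ).length → ℕ+ // Antitone k} :=
    { default := ⟨fun i => i.elim0, fun i => i.elim0⟩
      uniq := fun a => Subtype.ext (funext fun i => i.elim0) }
  rw [zetaStar, tsum_fintype, Fintype.sum_unique]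
  simp

theorem zetaStar_cons (s : ℕ) (l : List ℕ) :
    zetaStar (s :: l) = ∑' k : ℕ, starSum l (k + 1) / ((k : ℝ) + 1) ^ s := by
  have h0 : ∀ k : ℕ, 0 ≤ starSum l (k + 1) / ((k : ℝ) + 1) ^ s :=
    fun k => div_nonneg (starSum_nonneg _ _) (by positivity)
  rw [zetaStar_eq_toReal, starTsum_cons s l isLowerSet_univ, ← Equiv.pnatEquivNat.symm.tsum_eq]
  refine (congrArg ENNReal.toReal (tsum_congr fun k => ?_)).trans
    ((ENNReal.tsum_toReal_eq (f := fun k : ℕ =>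
      ENNReal.ofReal (starSum l (k + 1) / ((k : ℝ) + 1) ^ s))
      fun _ => ENNReal.ofReal_ne_top).trans (tsum_congr fun k => ENNReal.toReal_ofReal (h0 k)))
  have h2 : (Set.Iic (Equiv.pnatEquivNat.symm k) : Set ℕ+) = {m : ℕ+ | (m : ℕ) ≤ k + 1} := by
    ext m
    simp [Equiv.pnatEquivNat, ← PNat.coe_le_coe]
  rw [if_pos (Set.mem_univ _), h2, starTsum_Iic]
  exact ofReal_one_div_mul_ofReal s k _

/-- A multiple zeta star value is the limit of its truncations as soon as these are bounded. -/
theorem tendsto_starSum {l : List ℕ} {C : ℝ} (h : ∀ n, starSum l n ≤ C) :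
    Filter.Tendsto (starSum l) Filter.atTop (nhds (zetaStar l)) := by
  cases l with
  | nil =>
    rw [zetaStar_nil]
    exact tendsto_const_nhds.congr fun n => (starSum_nil n).symm
  | cons s l =>
    rw [zetaStar_cons]
    have hs : Summable fun k : ℕ => starSum l (k + 1) / ((k : ℝ) + 1) ^ s :=
      summable_of_sum_range_le (fun k => div_nonneg (starSum_nonneg _ _) (by positivity))
        (fun n => by rw [← starSum_cons]; exact h n)
    exact hs.hasSum.tendsto_sum_nat.congr fun n => (starSum_cons s l n).symm

/-! ### Alternating indices and recursions in the truncation level -/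

/-- The index `({2}^{a₁}, s₁, {2}^{a₂}, s₂, …, {2}^{a_j}, s_j)` where the `s_i` alternate between
`3` and `1`, with `s_j = 1`. -/
def altIndex (j : ℕ) (a : Fin j → ℕ) : List ℕ :=
  (List.ofFn fun i : Fin j =>
    List.replicate (a i) 2 ++ [if (j - i) % 2 = 0 then 3 else 1]).flatten

theorem index31_eq_altIndex (d : ℕ) (a : Fin (2 * d) → ℕ) : index31 d a = altIndex (2 * d) a := by
  unfold index31 altIndex
  congr 2
  funext i
  have : ((i : ℕ) % 2 = 0) ↔ ((2 * d - i) % 2 = 0) := by omega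
  simp [this]

theorem altIndex_cons (j b : ℕ) (a : Fin j → ℕ) :
    altIndex (j + 1) (Fin.cons b a) =
      List.replicate b 2 ++ (if (j + 1) % 2 = 0 then 3 else 1) :: altIndex j a := by
  simp [altIndex, List.ofFn_succ]

theorem sum_antidiagonalTuple_succ {M : Type*} [AddCommMonoid M] (j n : ℕ)
    (f : (Fin (j + 1) → ℕ) → M) :
    ∑ a ∈ Finset.Nat.antidiagonalTuple (j + 1) n, f a =
      ∑ p ∈ Finset.HasAntidiagonal.antidiagonal n, ∑ a ∈ Finset.Nat.antidiagonalTuple j p.2,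
        f (Fin.cons p.1 a) := by
  rw [Finset.sum_sigma']
  symm
  refine Finset.sum_bij' (fun x _ => Fin.cons x.1.1 x.2)
    (fun a _ => ⟨(a 0, ∑ i : Fin j, a i.succ), fun i => a i.succ⟩) ?_ ?_ ?_ ?_ ?_
  · rintro ⟨⟨b, c⟩, a⟩ h
    simp only [Finset.mem_sigma, Finset.HasAntidiagonal.mem_antidiagonal, Finset.Nat.mem_antidiagonalTuple] at h
    simp [Finset.Nat.mem_antidiagonalTuple, Fin.sum_univ_succ, h.1, h.2]
  · intro a h
    rw [Finset.Nat.mem_antidiagonalTuple, Fin.sum_univ_succ] at h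
    simp [Finset.Nat.mem_antidiagonalTuple, h]
  · rintro ⟨⟨b, c⟩, a⟩ h
    simp only [Finset.mem_sigma, Finset.HasAntidiagonal.mem_antidiagonal, Finset.Nat.mem_antidiagonalTuple] at h
    simp [h.2]
  · intro a h
    exact Fin.cons_self_tail a
  · intros; rfl

section Recursion

variable {j s : ℕ} {w : (Fin (j + 1) → ℕ) → List ℕ} {v : (Fin j → ℕ) → List ℕ}

theorem sum_starSum_zero_succ (hw : ∀ b a, w (Fin.cons b a) = List.replicate b 2 ++ s :: v a)
    (N : ℕ) :
    ∑ a ∈ Finset.Nat.antidiagonalTuple (j + 1) 0, starSum (w a) (N + 1) =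
      ∑ a ∈ Finset.Nat.antidiagonalTuple (j + 1) 0, starSum (w a) N +
      (∑ a ∈ Finset.Nat.antidiagonalTuple j 0, starSum (v a) (N + 1)) / ((N : ℝ) + 1) ^ s := by
  simp [sum_antidiagonalTuple_succ, hw, starSum_cons_succ, Finset.sum_add_distrib, Finset.sum_div]

/-- The two correction terms are the strings whose first letter is a `2` (`b > 0`; removing it
lowers `n` by one) and those whose first letter is `s` (`b = 0`; removing it drops a block). -/
theorem sum_starSum_succ_succ (hw : ∀ b a, w (Fin.cons b a) = List.replicate b 2 ++ s :: v a)
    (n N : ℕ) :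
    ∑ a ∈ Finset.Nat.antidiagonalTuple (j + 1) (n + 1), starSum (w a) (N + 1) =
      ∑ a ∈ Finset.Nat.antidiagonalTuple (j + 1) (n + 1), starSum (w a) N +
      (∑ a ∈ Finset.Nat.antidiagonalTuple (j + 1) n, starSum (w a) (N + 1)) / ((N : ℝ) + 1) ^ 2 +
      (∑ a ∈ Finset.Nat.antidiagonalTuple j (n + 1), starSum (v a) (N + 1)) /
        ((N : ℝ) + 1) ^ s := by
  simp only [sum_antidiagonalTuple_succ, hw, Finset.Nat.sum_antidiagonal_succ,
    List.replicate_zero, List.nil_append, List.replicate_succ, List.cons_append,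
    starSum_cons_succ, Finset.sum_add_distrib, Finset.sum_div]
  ring

end Recursion

/-- The truncated sums whose limits are the `Z⋆₀`, for any number `j` of letters `3` and `1`. -/
noncomputable def zSum (j n N : ℕ) : ℝ :=
  ∑ a ∈ Finset.Nat.antidiagonalTuple j n, starSum (altIndex j a) N

/-- The truncated sums whose limits are the `Z⋆₁`, for any number `j` of letters `3` and `1`. -/
noncomputable def zSumTail (j n N : ℕ) : ℝ :=
  ∑ a ∈ Finset.Nat.antidiagonalTuple (j + 1) n,
    starSum (altIndex j (fun i => a i.castSucc) ++ List.replicate (a (Fin.last j) + 1) 2) N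

theorem zSum_nonneg (j n N : ℕ) : 0 ≤ zSum j n N :=
  Finset.sum_nonneg fun _ _ => starSum_nonneg _ _

theorem zSumTail_nonneg (j n N : ℕ) : 0 ≤ zSumTail j n N :=
  Finset.sum_nonneg fun _ _ => starSum_nonneg _ _

theorem zSum_zero_zero (N : ℕ) : zSum 0 0 N = 1 := by
  simp [zSum, altIndex, starSum_nil]

theorem zSum_zero_succ (n N : ℕ) : zSum 0 (n + 1) N = 0 := by
  simp [zSum]

theorem altIndex_append_tail_cons (j b : ℕ) (a : Fin (j + 1) → ℕ) :
    altIndex (j + 1) (fun i => (Fin.cons b a : Fin (j + 2) → ℕ) i.castSucc) ++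
        List.replicate ((Fin.cons b a : Fin (j + 2) → ℕ) (Fin.last (j + 1)) + 1) 2 =
      List.replicate b 2 ++ (if (j + 1) % 2 = 0 then 3 else 1) ::
        (altIndex j (fun i => a i.castSucc) ++ List.replicate (a (Fin.last j) + 1) 2) := by
  have h : (fun i : Fin (j + 1) => (Fin.cons b a : Fin (j + 2) → ℕ) i.castSucc) =
      Fin.cons b (fun i => a i.castSucc) := by
    funext i
    refine Fin.cases ?_ (fun i => ?_) i
    · simp
    · rw [Fin.castSucc_succ]; simp
  rw [h, altIndex_cons, ← Fin.succ_last, Fin.cons_succ]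
  simp

theorem zSum_succ_zero_succ (j N : ℕ) :
    zSum (j + 1) 0 (N + 1) = zSum (j + 1) 0 N +
      zSum j 0 (N + 1) / ((N : ℝ) + 1) ^ (if (j + 1) % 2 = 0 then 3 else 1) :=
  sum_starSum_zero_succ (altIndex_cons j) N

theorem zSum_succ_succ_succ (j n N : ℕ) :
    zSum (j + 1) (n + 1) (N + 1) = zSum (j + 1) (n + 1) N +
      zSum (j + 1) n (N + 1) / ((N : ℝ) + 1) ^ 2 +
      zSum j (n + 1) (N + 1) / ((N : ℝ) + 1) ^ (if (j + 1) % 2 = 0 then 3 else 1) :=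
  sum_starSum_succ_succ (altIndex_cons j) n N

theorem zSumTail_succ_zero_succ (j N : ℕ) :
    zSumTail (j + 1) 0 (N + 1) = zSumTail (j + 1) 0 N +
      zSumTail j 0 (N + 1) / ((N : ℝ) + 1) ^ (if (j + 1) % 2 = 0 then 3 else 1) :=
  sum_starSum_zero_succ (altIndex_append_tail_cons j) N

theorem zSumTail_succ_succ_succ (j n N : ℕ) :
    zSumTail (j + 1) (n + 1) (N + 1) = zSumTail (j + 1) (n + 1) N +
      zSumTail (j + 1) n (N + 1) / ((N : ℝ) + 1) ^ 2 +
      zSumTail j (n + 1) (N + 1) / ((N : ℝ) + 1) ^ (if (j + 1) % 2 = 0 then 3 else 1) :=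
  sum_starSum_succ_succ (altIndex_append_tail_cons j) n N

theorem zSumTail_zero (n N : ℕ) : zSumTail 0 n N = starSum (List.replicate (n + 1) 2) N := by
  simp [zSumTail, altIndex]

theorem zSumTail_zero_zero_succ (N : ℕ) :
    zSumTail 0 0 (N + 1) = zSumTail 0 0 N + 1 / ((N : ℝ) + 1) ^ 2 := by
  simp [zSumTail_zero, starSum_cons_succ, starSum_nil]

theorem zSumTail_zero_succ_succ (n N : ℕ) :
    zSumTail 0 (n + 1) (N + 1) = zSumTail 0 (n + 1) N +
      zSumTail 0 n (N + 1) / ((N : ℝ) + 1) ^ 2 := by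
  rw [zSumTail_zero, zSumTail_zero, zSumTail_zero, List.replicate_succ, starSum_cons_succ]

theorem zSum_succ_n_zero (j n : ℕ) : zSum (j + 1) n 0 = 0 := by
  refine Finset.sum_eq_zero fun a _ => ?_
  rw [← Fin.cons_self_tail a, altIndex_cons]
  cases a 0 <;> simp [List.replicate_succ, starSum_cons_zero]

theorem zSumTail_n_zero (j n : ℕ) : zSumTail j n 0 = 0 := by
  refine Finset.sum_eq_zero fun a _ => ?_
  cases j with
  | zero => simp [altIndex, List.replicate_succ, starSum_cons_zero]
  | succ j =>
    rw [← Fin.cons_self_tail a, altIndex_append_tail_cons]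
    cases a 0 <;> simp [List.replicate_succ, starSum_cons_zero]

/-! ### The connector transform and the explicit solution -/

section ExplicitSolution

variable {K : Type*} [Field K]

/-- The connector `n!² / ((n - k)! (n + k)!)`, which vanishes for `k > n`. -/
def connector (K : Type*) [Field K] (n k : ℕ) : K := (n.choose k : K) / ((n + k).choose k : K)

theorem connector_zero_right (n : ℕ) : connector K n 0 = 1 := by simp [connector]

theorem connector_eq_zero {n k : ℕ} (h : n < k) : connector K n k = 0 := by
  simp [connector, Nat.choose_eq_zero_of_lt h]

/-- The ratio of consecutive connectors in `k`; it drives the summation by parts in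
`natCast_mul_connectorSum`. -/
theorem connector_succ_right [CharZero K] (n k : ℕ) :
    ((n : K) - k) * connector K n k = (n + k + 1) * connector K n (k + 1) := by
  rcases lt_or_ge n k with h | h
  · simp [connector_eq_zero h, connector_eq_zero (h.trans (Nat.lt_succ_self k))]
  · have h1 : (n.choose (k + 1) : K) * (k + 1) = n.choose k * ((n : K) - k) := by
      have := Nat.choose_succ_right_eq n k
      rw [← Nat.cast_sub h]; exact_mod_cast this
    have h2 : ((n + k + 1).choose (k + 1) : K) * (k + 1) = (n + k + 1) * (n + k).choose k := by
      have := Nat.add_one_mul_choose_eq (n + k) k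
      exact_mod_cast this.symm
    have h3 : ((n + k).choose k : K) ≠ 0 := by
      exact_mod_cast (Nat.choose_pos (Nat.le_add_left k n)).ne'
    have h4 : ((n + k + 1).choose (k + 1) : K) ≠ 0 := by
      exact_mod_cast (Nat.choose_pos (by omega)).ne'
    have h5 : (k : K) + 1 ≠ 0 := by exact_mod_cast k.succ_ne_zero
    unfold connector
    rw [← add_assoc n k 1, mul_div_assoc', mul_div_assoc', div_eq_div_iff h3 h4]
    refine mul_right_cancel₀ h5 ?_
    linear_combination ((n : K) - k) * n.choose k * h2 - (n + k + 1) * ((n + k).choose k : K) * h1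

/-- The key property of the connector: as a function of `n` it is an eigenvector, with eigenvalue
`k²`, of the difference operator in the recursions. -/
theorem connector_succ_left [CharZero K] (n k : ℕ) :
    ((n : K) + 1) ^ 2 * (connector K (n + 1) k - connector K n k) =
      (k : K) ^ 2 * connector K (n + 1) k := by
  have h1 : ((n + 1).choose k : K) * ((n : K) + 1 - k) = n.choose k * (n + 1) := by
    rcases le_or_gt k (n + 1) with h | h
    · have := Nat.choose_mul_succ_eq n k
      have h' : ((n + 1 - k : ℕ) : K) = (n : K) + 1 - k := by push_cast [h]; ring
      rw [← h']; exact_mod_cast this.symm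
    · simp [Nat.choose_eq_zero_of_lt h, Nat.choose_eq_zero_of_lt (show n < k by omega)]
  have h2 : ((n + k + 1).choose k : K) * (n + 1) = (n + k).choose k * (n + k + 1) := by
    have := Nat.choose_mul_succ_eq (n + k) k
    rw [show n + k + 1 - k = n + 1 by omega] at this
    exact_mod_cast this.symm
  have h3 : ((n + k).choose k : K) ≠ 0 := by
    exact_mod_cast (Nat.choose_pos (Nat.le_add_left k n)).ne'
  have h4 : ((n + k + 1).choose k : K) ≠ 0 := by
    exact_mod_cast (Nat.choose_pos (by omega)).ne'
  unfold connector
  rw [show n + 1 + k = n + k + 1 by omega]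
  field_simp
  linear_combination ((n : K) + 1) * ((n + k + 1).choose k : K) * h1 -
    ((n + 1).choose k : K) * ((n : K) + 1 - k) * h2

/-- The transform `r ↦ r 0 + ∑_{k=1}^n (r k - r (k-1)) n!² / ((n - k)! (n + k)!)`. -/
def connectorSum (r : ℕ → K) (n : ℕ) : K :=
  r 0 + ∑ k ∈ Finset.range n, (r (k + 1) - r k) * connector K n (k + 1)

theorem sum_range_mul_connector_of_le (c : ℕ → K) {n m : ℕ} (h : n ≤ m) :
    ∑ k ∈ Finset.range m, c k * connector K n (k + 1) =
      ∑ k ∈ Finset.range n, c k * connector K n (k + 1) := by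
  symm
  refine Finset.sum_subset (Finset.range_mono h) fun k _ hk => ?_
  rw [connector_eq_zero (by simpa using hk), mul_zero]

theorem sq_mul_sum_connector_sub [CharZero K] (c : ℕ → K) (n : ℕ) :
    ((n : K) + 1) ^ 2 * (∑ k ∈ Finset.range (n + 1), c k * connector K (n + 1) (k + 1) -
        ∑ k ∈ Finset.range n, c k * connector K n (k + 1)) =
      ∑ k ∈ Finset.range (n + 1), ((k : K) + 1) ^ 2 * c k * connector K (n + 1) (k + 1) := by
  rw [← sum_range_mul_connector_of_le c n.le_succ, ← Finset.sum_sub_distrib, Finset.mul_sum]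
  refine Finset.sum_congr rfl fun k _ => ?_
  have := connector_succ_left (K := K) n (k + 1)
  push_cast at this
  linear_combination c k * this

/-- Summation by parts trades differences of `r` for sums. This matters because for `s_k = (-1)^k
r_k` the two-term recursion of `altProd` is tractable in the combination `s_k + s_{k-1}`. -/
theorem natCast_mul_connectorSum [CharZero K] (r : ℕ → K) (n : ℕ) :
    (n : K) * connectorSum r n =
      ∑ k ∈ Finset.range n, ((k : K) + 1) * (r (k + 1) + r k) * connector K n (k + 1) := by
  -- For partial sums up to `m` there is a boundary term, which vanishes at `m = n`.
  have key : ∀ m : ℕ, (n : K) * (r 0 + ∑ k ∈ Finset.range m,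
        (r (k + 1) - r k) * connector K n (k + 1)) =
      ∑ k ∈ Finset.range m, ((k : K) + 1) * (r (k + 1) + r k) * connector K n (k + 1) +
        (n - m) * r m * connector K n m := by
    intro m
    induction m with
    | zero => simp [connector_zero_right]
    | succ m ih =>
      rw [Finset.sum_range_succ, Finset.sum_range_succ, ← add_assoc, mul_add, ih]
      have := connector_succ_right (K := K) n m
      push_cast
      linear_combination r m * this
  rw [connectorSum, key n]; simp

/-- The partial products of `∏ (k² - Z + (-1)^k W) / (k² - Z - (-1)^k W)`. -/
def altProd (Z W : K) (n : ℕ) : K :=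
  ∏ k ∈ Finset.range n, (((k : K) + 1) ^ 2 - Z + (-1) ^ (k + 1) * W) /
    (((k : K) + 1) ^ 2 - Z - (-1) ^ (k + 1) * W)

theorem altProd_zero (Z W : K) : altProd Z W 0 = 1 := by simp [altProd]

theorem altProd_succ {Z W : K} {n : ℕ} (h : ((n : K) + 1) ^ 2 - Z - (-1) ^ (n + 1) * W ≠ 0) :
    altProd Z W (n + 1) * (((n : K) + 1) ^ 2 - Z - (-1) ^ (n + 1) * W) =
      altProd Z W n * (((n : K) + 1) ^ 2 - Z + (-1) ^ (n + 1) * W) := by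
  rw [altProd, Finset.prod_range_succ, ← altProd]
  field_simp

theorem altProd_sub {Z W : K} {n : ℕ} (h : ((n : K) + 1) ^ 2 - Z - (-1) ^ (n + 1) * W ≠ 0) :
    (((n : K) + 1) ^ 2 - Z) * (altProd Z W (n + 1) - altProd Z W n) =
      W * ((-1) ^ (n + 1) * altProd Z W (n + 1) - (-1) ^ n * altProd Z W n) := by
  have := altProd_succ h
  rw [pow_succ] at *
  linear_combination this

theorem altProd_add {Z W : K} {n : ℕ} (h : ((n : K) + 1) ^ 2 - Z - (-1) ^ (n + 1) * W ≠ 0) :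
    (((n : K) + 1) ^ 2 - Z) * ((-1) ^ (n + 1) * altProd Z W (n + 1) + (-1) ^ n * altProd Z W n) =
      W * (altProd Z W (n + 1) + altProd Z W n) := by
  have := altProd_succ h
  have h1 : ((-1 : K) ^ n) * (-1) ^ n = 1 := by rw [← mul_pow]; simp
  rw [pow_succ] at *
  linear_combination (-(-1) ^ n) * this + W * (altProd Z W (n + 1) + altProd Z W n) * h1

variable [CharZero K] {Z W : K}

/-- The closed forms of the truncated generating functions satisfy their first recursion. -/
theorem connectorSum_altProd_rec
    (h : ∀ n : ℕ, ((n : K) + 1) ^ 2 - Z - (-1) ^ (n + 1) * W ≠ 0) (n : ℕ) :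
    ((n : K) + 1) ^ 2 * (connectorSum (altProd Z W) (n + 1) - connectorSum (altProd Z W) n) =
      Z * connectorSum (altProd Z W) (n + 1) +
        W * connectorSum (fun k => (-1) ^ k * altProd Z W k) (n + 1) - (Z + W) := by
  simp only [connectorSum, altProd_zero, add_sub_add_left_eq_sub, sq_mul_sum_connector_sub,
    pow_zero, mul_one]
  rw [← sub_eq_zero]
  have : ∀ a b : K, Z * (1 + a) + W * (1 + b) - (Z + W) = Z * a + W * b := by intros; ring
  rw [this, Finset.mul_sum, Finset.mul_sum, ← Finset.sum_add_distrib, ← Finset.sum_sub_distrib]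
  refine Finset.sum_eq_zero fun k _ => ?_
  linear_combination connector K (n + 1) (k + 1) * altProd_sub (h k)

/-- The closed forms of the truncated generating functions satisfy their second recursion. -/
theorem mul_connectorSum_altProd_rec
    (h : ∀ n : ℕ, ((n : K) + 1) ^ 2 - Z - (-1) ^ (n + 1) * W ≠ 0) (n : ℕ) :
    ((n : K) + 1) ^ 2 *
        ((n + 1 : K) * connectorSum (fun k => (-1) ^ k * altProd Z W k) (n + 1) -
          n * connectorSum (fun k => (-1) ^ k * altProd Z W k) n) =
      Z * ((n + 1 : K) * connectorSum (fun k => (-1) ^ k * altProd Z W k) (n + 1)) +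
        W * (n + 1) * connectorSum (altProd Z W) (n + 1) := by
  have h1 := natCast_mul_connectorSum (fun k => (-1) ^ k * altProd Z W k) (n + 1)
  have h2 := natCast_mul_connectorSum (altProd Z W) (n + 1)
  push_cast at h1 h2
  rw [mul_assoc W, h1, h2, natCast_mul_connectorSum, sq_mul_sum_connector_sub, ← sub_eq_zero,
    Finset.mul_sum, Finset.mul_sum, ← Finset.sum_add_distrib, ← Finset.sum_sub_distrib]
  refine Finset.sum_eq_zero fun k _ => ?_
  linear_combination ((k : K) + 1) * connector K (n + 1) (k + 1) * altProd_add (h k)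

end ExplicitSolution

/-! ### Convergence of the product and of its transform -/

section Bounds

variable {𝕜 : Type*} [RCLike 𝕜]

theorem norm_connector_le_one (n k : ℕ) : ‖connector 𝕜 n k‖ ≤ 1 := by
  rw [connector, norm_div, RCLike.norm_natCast, RCLike.norm_natCast]
  exact div_le_one_of_le₀ (by exact_mod_cast Nat.choose_mono k (Nat.le_add_right n k))
    (by positivity)

theorem tendsto_connector (k : ℕ) :
    Filter.Tendsto (fun n => connector 𝕜 n k) Filter.atTop (nhds 1) := by
  induction k with
  | zero => simp [connector_zero_right]
  | succ k ih =>
    have h1 : Filter.Tendsto (fun n : ℕ => ((2 * k + 1 : ℕ) : 𝕜) / ((n + k + 1 : ℕ) : 𝕜))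
        Filter.atTop (nhds 0) := by
      have := (tendsto_const_div_atTop_nhds_zero_nat ((2 * k + 1 : ℕ) : ℝ)).comp
        (Filter.tendsto_add_atTop_nat (k + 1))
      rw [tendsto_zero_iff_norm_tendsto_zero]
      refine this.congr fun n => ?_
      rw [norm_div, RCLike.norm_natCast, RCLike.norm_natCast]
      simp [add_assoc]
    have h2 : Filter.Tendsto (fun n : ℕ => (1 - ((2 * k + 1 : ℕ) : 𝕜) / ((n + k + 1 : ℕ) : 𝕜)) *
        connector 𝕜 n k) Filter.atTop (nhds ((1 - 0) * 1)) := (tendsto_const_nhds.sub h1).mul ih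
    rw [sub_zero, one_mul] at h2
    refine h2.congr fun n => ?_
    have h3 := connector_succ_right (K := 𝕜) n k
    have h4 : (n : 𝕜) + k + 1 ≠ 0 := by exact_mod_cast (n + k).succ_ne_zero
    push_cast
    field_simp
    linear_combination h3

variable {Z : 𝕜} {R : ℝ}

theorem exists_mul_sq_le_norm_sub (hZ : ‖Z‖ < 1) (hR : R < ‖1 - Z‖) :
    ∃ δ : ℝ, 0 < δ ∧ ∀ (k : ℕ) (W : 𝕜), ‖W‖ ≤ R →
      δ * ((k : ℝ) + 1) ^ 2 ≤ ‖((k : 𝕜) + 1) ^ 2 - Z - (-1) ^ (k + 1) * W‖ := by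
  -- The first entry serves `k = 0`. For `k ≥ 1`, `‖Z‖ + R < 3` and `(k + 1)² ≥ 4` give `(k + 1)² -
  -- 3 ≥ (k + 1)² / 4`.
  refine ⟨min (‖1 - Z‖ - R) (1 / 4), lt_min (by linarith) (by norm_num), fun k W hW => ?_⟩
  have h1 : ‖((k : 𝕜) + 1) ^ 2 - Z‖ - ‖W‖ ≤ ‖((k : 𝕜) + 1) ^ 2 - Z - (-1) ^ (k + 1) * W‖ := by
    have := norm_sub_norm_le (((k : 𝕜) + 1) ^ 2 - Z) ((-1) ^ (k + 1) * W)
    simpa using this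
  rcases Nat.eq_zero_or_pos k with rfl | hk
  · simp only [Nat.cast_zero, zero_add, one_pow, mul_one] at h1 ⊢
    exact (min_le_left _ _).trans (le_trans (by linarith) h1)
  · have h2 : ((k : ℝ) + 1) ^ 2 - ‖Z‖ ≤ ‖((k : 𝕜) + 1) ^ 2 - Z‖ := by
      have := norm_sub_norm_le (((k : 𝕜) + 1) ^ 2) Z
      have h : ‖((k : 𝕜) + 1) ^ 2‖ = ((k : ℝ) + 1) ^ 2 := by
        rw [norm_pow, ← Nat.cast_succ, RCLike.norm_natCast, Nat.cast_succ]
      rwa [h] at this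
    have h3 : ‖1 - Z‖ ≤ 1 + ‖Z‖ := by simpa using norm_sub_le 1 Z
    have h4 : min (‖1 - Z‖ - R) (1 / 4) * ((k : ℝ) + 1) ^ 2 ≤ 1 / 4 * ((k : ℝ) + 1) ^ 2 := by
      gcongr; exact min_le_right _ _
    have h5 : (1 : ℝ) ≤ k := by exact_mod_cast hk
    nlinarith

theorem sq_sub_ne_zero (hZ : ‖Z‖ < 1) {W : 𝕜} (hW : ‖W‖ < ‖1 - Z‖) (k : ℕ) :
    ((k : 𝕜) + 1) ^ 2 - Z - (-1) ^ (k + 1) * W ≠ 0 := by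
  obtain ⟨δ, hδ, h⟩ := exists_mul_sq_le_norm_sub hZ hW
  rw [← norm_pos_iff]
  exact lt_of_lt_of_le (by positivity) (h k W le_rfl)

/-- Each factor is `1 + O(1/k²)` uniformly for `‖W‖ ≤ R`, so the partial products are uniformly
bounded and their increments are `O(1/k²)`. The uniformity in `W` is what yields holomorphy of the
limit. -/
theorem exists_summable_altProd_sub_le (hZ : ‖Z‖ < 1) (hR : R < ‖1 - Z‖) :
    ∃ u : ℕ → ℝ, Summable u ∧ ∀ (k : ℕ) (W : 𝕜), ‖W‖ ≤ R →
      ‖altProd Z W (k + 1) - altProd Z W k‖ ≤ u k := by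
  obtain ⟨δ, hδ, hb⟩ := exists_mul_sq_le_norm_sub hZ hR
  rcases lt_or_ge R 0 with hR0 | hR0
  · exact ⟨0, summable_zero, fun k W hW => absurd (norm_nonneg W) (by linarith)⟩
  set v : ℕ → ℝ := fun k => 2 * R / δ * (1 / ((k : ℝ) + 1) ^ 2) with hv
  have hv0 : ∀ k, 0 ≤ v k := fun k => by positivity
  have hvs : Summable v := by
    have := (summable_nat_add_iff 1).mpr (Real.summable_one_div_nat_pow.mpr one_lt_two)
    exact Summable.mul_left _ (by simpa using this)
  have hfac : ∀ (k : ℕ) (W : 𝕜), ‖W‖ ≤ R →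
      ‖2 * ((-1) ^ (k + 1) * W) / (((k : 𝕜) + 1) ^ 2 - Z - (-1) ^ (k + 1) * W)‖ ≤ v k := by
    intro k W hW
    have h2 : 0 < δ * ((k : ℝ) + 1) ^ 2 := by positivity
    rw [norm_div, show v k = 2 * R / (δ * ((k : ℝ) + 1) ^ 2) by simp only [hv]; field_simp]
    refine div_le_div₀ (by positivity) ?_ h2 (hb k W hW)
    simpa using hW
  have heq : ∀ (k : ℕ) (W : 𝕜), ‖W‖ ≤ R →
      (((k : 𝕜) + 1) ^ 2 - Z + (-1) ^ (k + 1) * W) / (((k : 𝕜) + 1) ^ 2 - Z - (-1) ^ (k + 1) * W) =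
      1 + 2 * ((-1) ^ (k + 1) * W) / (((k : 𝕜) + 1) ^ 2 - Z - (-1) ^ (k + 1) * W) := by
    intro k W hW
    have := sq_sub_ne_zero hZ (hW.trans_lt hR) k
    rw [eq_comm, one_add_div this]
    congr 1; ring
  have hprod : ∀ (k : ℕ) (W : 𝕜), ‖W‖ ≤ R → ‖altProd Z W k‖ ≤ Real.exp (∑' i, v i) := by
    intro k W hW
    rw [altProd, norm_prod]
    calc _ ≤ ∏ i ∈ Finset.range k, (1 + v i) := by
          refine Finset.prod_le_prod (fun _ _ => norm_nonneg _) fun i _ => ?_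
          rw [heq i W hW]
          refine (norm_add_le _ _).trans ?_
          rw [norm_one]
          exact add_le_add_right (hfac i W hW) 1
      _ ≤ Real.exp (∑ i ∈ Finset.range k, v i) :=
          Real.prod_one_add_le_exp_sum _ fun i => hv0 i
      _ ≤ _ := Real.exp_le_exp.mpr (hvs.sum_le_tsum _ fun i _ => hv0 i)
  refine ⟨fun k => Real.exp (∑' i, v i) * v k, hvs.mul_left _, fun k W hW => ?_⟩
  rw [altProd, Finset.prod_range_succ, ← altProd, heq k W hW, mul_add, mul_one,
    add_sub_cancel_left, norm_mul]
  exact mul_le_mul (hprod k W hW) (hfac k W hW) (norm_nonneg _) (Real.exp_pos _).le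

/-- The infinite product `∏ (k² - Z + (-1)^k W) / (k² - Z - (-1)^k W)`, as a telescoping series. -/
noncomputable def altProdLim (Z W : 𝕜) : 𝕜 := 1 + ∑' k : ℕ, (altProd Z W (k + 1) - altProd Z W k)

theorem summable_norm_altProd_sub (hZ : ‖Z‖ < 1) {W : 𝕜} (hW : ‖W‖ < ‖1 - Z‖) :
    Summable fun k : ℕ => ‖altProd Z W (k + 1) - altProd Z W k‖ := by
  obtain ⟨u, hu, h⟩ := exists_summable_altProd_sub_le hZ hW
  exact Summable.of_nonneg_of_le (fun _ => norm_nonneg _) (fun k => h k W le_rfl) hu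

theorem tendsto_altProd (hZ : ‖Z‖ < 1) {W : 𝕜} (hW : ‖W‖ < ‖1 - Z‖) :
    Filter.Tendsto (altProd Z W) Filter.atTop (nhds (altProdLim Z W)) := by
  have := (summable_norm_altProd_sub hZ hW).of_norm.hasSum.tendsto_sum_nat.const_add 1
  refine this.congr fun n => ?_
  rw [Finset.sum_range_sub, altProd_zero]; ring

theorem connectorSum_altProd_eq_tsum (Z W : 𝕜) (n : ℕ) :
    connectorSum (altProd Z W) n =
      1 + ∑' k : ℕ, (altProd Z W (k + 1) - altProd Z W k) * connector 𝕜 n (k + 1) := by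
  rw [connectorSum, altProd_zero, tsum_eq_sum]
  intro k hk
  rw [connector_eq_zero (by simpa using hk), mul_zero]

/-- Dominated convergence: connectors have norm at most `1` and tend to `1`, and the increments of
`altProd` are absolutely summable. -/
theorem tendsto_connectorSum_altProd (hZ : ‖Z‖ < 1) {W : 𝕜} (hW : ‖W‖ < ‖1 - Z‖) :
    Filter.Tendsto (connectorSum (altProd Z W)) Filter.atTop (nhds (altProdLim Z W)) := by
  refine Filter.Tendsto.congr (fun n => (connectorSum_altProd_eq_tsum Z W n).symm) ?_
  refine Filter.Tendsto.const_add 1 ?_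
  refine tendsto_tsum_of_dominated_convergence (summable_norm_altProd_sub hZ hW) (fun k => ?_)
    (Filter.Eventually.of_forall fun n k => ?_)
  · simpa using (tendsto_connector (𝕜 := 𝕜) (k + 1)).const_mul (altProd Z W (k + 1) - altProd Z W k)
  · rw [norm_mul]
    exact mul_le_of_le_one_right (norm_nonneg _) (norm_connector_le_one _ _)

end Bounds

theorem differentiableOn_altProdLim {Z : ℂ} (hZ : ‖Z‖ < 1) {R : ℝ} (hR : R < ‖1 - Z‖) :
    DifferentiableOn ℂ (altProdLim Z) (Metric.ball 0 R) := by
  obtain ⟨u, hu, h⟩ := exists_summable_altProd_sub_le hZ hR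
  have hd : ∀ k : ℕ, DifferentiableOn ℂ (fun W => altProd Z W k) (Metric.ball 0 R) := by
    intro k
    unfold altProd
    refine DifferentiableOn.fun_finsetProd fun i _ => ?_
    refine DifferentiableOn.div (by fun_prop) (by fun_prop) fun W hW => ?_
    exact sq_sub_ne_zero hZ ((mem_ball_zero_iff.mp hW).trans hR) i
  unfold altProdLim
  refine DifferentiableOn.const_add 1 ?_
  exact Complex.differentiableOn_tsum_of_summable_norm hu (fun k => (hd (k + 1)).sub (hd k))
    Metric.isOpen_ball fun k W hW => h k W (mem_ball_zero_iff.mp hW).le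

/-! ### Combining the two families with a weight `V` -/

section MixedSums

variable {K : Type*} [Field K] [Algebra ℝ K]

/-- The truncated sums `zSum + V * zSumTail` in an `ℝ`-algebra. -/
noncomputable def mixSum (V : K) (j n N : ℕ) : K :=
  algebraMap ℝ K (zSum j n N) + V * algebraMap ℝ K (zSumTail j n N)

theorem mixSum_succ_zero_succ (V : K) (j N : ℕ) :
    mixSum V (j + 1) 0 (N + 1) = mixSum V (j + 1) 0 N +
      mixSum V j 0 (N + 1) / ((N : K) + 1) ^ (if (j + 1) % 2 = 0 then 3 else 1) := by
  simp only [mixSum, zSum_succ_zero_succ, zSumTail_succ_zero_succ, map_add, map_div₀, map_pow,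
    map_natCast, map_one]
  ring

theorem mixSum_succ_succ_succ (V : K) (j n N : ℕ) :
    mixSum V (j + 1) (n + 1) (N + 1) = mixSum V (j + 1) (n + 1) N +
      mixSum V (j + 1) n (N + 1) / ((N : K) + 1) ^ 2 +
      mixSum V j (n + 1) (N + 1) / ((N : K) + 1) ^ (if (j + 1) % 2 = 0 then 3 else 1) := by
  simp only [mixSum, zSum_succ_succ_succ, zSumTail_succ_succ_succ, map_add, map_div₀, map_pow,
    map_natCast, map_one]
  ring

theorem mixSum_zero_zero_succ (V : K) (N : ℕ) :
    mixSum V 0 0 (N + 1) = mixSum V 0 0 N + V / ((N : K) + 1) ^ 2 := by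
  simp only [mixSum, zSum_zero_zero, zSumTail_zero_zero_succ, map_add, map_div₀, map_pow,
    map_natCast, map_one]
  ring

/-- The subtracted `1` is the empty index: it contributes to `mixSum V 0 0`, but no string of `2`s
in the tail family arises by prepending a `2` to it with weight `1`. -/
theorem mixSum_zero_succ_succ (V : K) (n N : ℕ) :
    mixSum V 0 (n + 1) (N + 1) = mixSum V 0 (n + 1) N +
      (mixSum V 0 n (N + 1) - if n = 0 then 1 else 0) / ((N : K) + 1) ^ 2 := by
  cases n <;>
  · simp only [mixSum, zSum_zero_zero, zSum_zero_succ, zSumTail_zero_succ_succ, map_add, map_div₀,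
      map_pow, map_natCast, map_one, map_zero, if_true, Nat.add_eq_zero_iff, one_ne_zero,
      and_false, if_false]
    ring

theorem mixSum_zero_zero_zero (V : K) : mixSum V 0 0 0 = 1 := by
  simp [mixSum, zSum_zero_zero, zSumTail_n_zero]

theorem mixSum_zero_succ_zero (V : K) (n : ℕ) : mixSum V 0 (n + 1) 0 = 0 := by
  simp [mixSum, zSum_zero_succ, zSumTail_n_zero]

theorem mixSum_succ_zero (V : K) (j n : ℕ) : mixSum V (j + 1) n 0 = 0 := by
  simp [mixSum, zSum_succ_n_zero, zSumTail_n_zero]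

end MixedSums

/-! ### A priori bounds at nonnegative parameters -/

section PositiveBound

variable {r t : ℝ}

theorem mixSum_nonneg (ht : 0 ≤ t) (j n N : ℕ) : 0 ≤ mixSum t j n N :=
  add_nonneg (zSum_nonneg _ _ _) (mul_nonneg ht (zSumTail_nonneg _ _ _))

/-- Multiplication by `r` shifts degrees, so the exact recursion involves the sum over `n < M`;
enlarging it to `n ≤ M` adds a nonnegative term and closes the system as an inequality. -/
theorem sum_mixSum_succ_le (hr : 0 ≤ r) (ht : 0 ≤ t) (j M N : ℕ) :
    ∑ n ∈ Finset.range (M + 1), mixSum t (j + 1) n (N + 1) * r ^ n ≤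
      ∑ n ∈ Finset.range (M + 1), mixSum t (j + 1) n N * r ^ n +
      r / ((N : ℝ) + 1) ^ 2 * ∑ n ∈ Finset.range (M + 1), mixSum t (j + 1) n (N + 1) * r ^ n +
      (∑ n ∈ Finset.range (M + 1), mixSum t j n (N + 1) * r ^ n) /
        ((N : ℝ) + 1) ^ (if (j + 1) % 2 = 0 then 3 else 1) := by
  have h : ∑ n ∈ Finset.range M, mixSum t (j + 1) n (N + 1) * r ^ n ≤
      ∑ n ∈ Finset.range (M + 1), mixSum t (j + 1) n (N + 1) * r ^ n := by
    rw [Finset.sum_range_succ]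
    exact le_add_of_nonneg_right (mul_nonneg (mixSum_nonneg ht _ _ _) (by positivity))
  refine le_trans (le_of_eq ?_) (add_le_add_left (add_le_add_right
    (mul_le_mul_of_nonneg_left h (show 0 ≤ r / ((N : ℝ) + 1) ^ 2 by positivity)) _) _)
  rw [Finset.sum_range_succ', Finset.sum_range_succ' _ M, Finset.sum_range_succ' _ M,
    mixSum_succ_zero_succ]
  simp only [mixSum_succ_succ_succ, add_mul, Finset.sum_add_distrib, Finset.mul_sum,
    add_div, Finset.sum_div]
  have : ∀ n, mixSum t (j + 1) n (N + 1) / ((N : ℝ) + 1) ^ 2 * r ^ (n + 1) =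
      r / ((N : ℝ) + 1) ^ 2 * (mixSum t (j + 1) n (N + 1) * r ^ n) := fun n => by ring
  simp only [this, div_mul_eq_mul_div]
  ring

theorem sum_mixSum_zero_le (hr : 0 ≤ r) (ht : 0 ≤ t) (M N : ℕ) :
    ∑ n ∈ Finset.range (M + 1), mixSum t 0 n (N + 1) * r ^ n ≤
      ∑ n ∈ Finset.range (M + 1), mixSum t 0 n N * r ^ n +
      r / ((N : ℝ) + 1) ^ 2 * (∑ n ∈ Finset.range (M + 1), mixSum t 0 n (N + 1) * r ^ n - 1) +
      t / ((N : ℝ) + 1) ^ 2 := by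
  have hge : ∀ N, 1 ≤ mixSum t 0 0 N := fun N => by
    have : mixSum t 0 0 N = 1 + t * zSumTail 0 0 N := by simp [mixSum, zSum_zero_zero]
    rw [this]
    exact le_add_of_nonneg_right (mul_nonneg ht (zSumTail_nonneg _ _ _))
  have h : ∑ n ∈ Finset.range M, (mixSum t 0 n (N + 1) - if n = 0 then 1 else 0) * r ^ n ≤
      ∑ n ∈ Finset.range (M + 1), mixSum t 0 n (N + 1) * r ^ n - 1 := by
    have h1 : ∑ n ∈ Finset.range (M + 1), (if n = 0 then (1 : ℝ) else 0) * r ^ n = 1 := by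
      rw [Finset.sum_range_succ']; simp
    have h2 : ∑ n ∈ Finset.range (M + 1), mixSum t 0 n (N + 1) * r ^ n - 1 =
        ∑ n ∈ Finset.range (M + 1), (mixSum t 0 n (N + 1) - if n = 0 then 1 else 0) * r ^ n := by
      simp only [sub_mul, Finset.sum_sub_distrib, h1]
    rw [h2, Finset.sum_range_succ]
    refine le_add_of_nonneg_right (mul_nonneg ?_ (by positivity))
    split_ifs with h0
    · subst h0; exact sub_nonneg.mpr (hge _)
    · rw [sub_zero]; exact mixSum_nonneg ht _ _ _
  refine le_trans (le_of_eq ?_) (add_le_add_left (add_le_add_right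
    (mul_le_mul_of_nonneg_left h (show 0 ≤ r / ((N : ℝ) + 1) ^ 2 by positivity)) _) _)
  rw [Finset.sum_range_succ', Finset.sum_range_succ' _ M, mixSum_zero_zero_succ]
  simp only [mixSum_zero_succ_succ, add_mul, Finset.sum_add_distrib, Finset.mul_sum]
  have : ∀ n, (mixSum t 0 n (N + 1) - if n = 0 then 1 else 0) / ((N : ℝ) + 1) ^ 2 * r ^ (n + 1) =
      r / ((N : ℝ) + 1) ^ 2 * ((mixSum t 0 n (N + 1) - if n = 0 then 1 else 0) * r ^ n) :=
    fun n => by ring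
  simp only [this]
  ring

/-- Comparison of a subsolution with a solution of one step of the recursion. -/
theorem le_of_step_le {m r t p p' q q' X X' Y Y' : ℝ} (hm : 1 ≤ m) (ht : 0 ≤ t) (hrt : r + t < 1)
    (hp : m ^ 2 * (p' - p) ≤ r * p' + t / m * q' + t - r)
    (hq : m ^ 2 * (q' - q) ≤ r * q' + t * m * p')
    (hX : m ^ 2 * (X' - X) = r * X' + t / m * Y' + t - r)
    (hY : m ^ 2 * (Y' - Y) = r * Y' + t * m * X')
    (hpX : p ≤ X) (hqY : q ≤ Y) : p' ≤ X' ∧ q' ≤ Y' := by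
  have hm0 : 0 < m := by linarith
  have hm2 : 1 ≤ m ^ 2 := one_le_pow₀ hm
  have h1 : t / m * (Y' - q') ≤ (m ^ 2 - r) * (X' - p') := by nlinarith
  have h2 : t * m * (X' - p') ≤ (m ^ 2 - r) * (Y' - q') := by nlinarith
  -- Eliminating `Y' - q'` leaves the determinant `(m² - r)² - t²`, positive because `r + t < 1 ≤
  -- m²`; this forces `X' - p' ≥ 0`.
  have h3 : t ^ 2 * (X' - p') ≤ (m ^ 2 - r) ^ 2 * (X' - p') := by
    calc t ^ 2 * (X' - p') = t / m * (t * m * (X' - p')) := by field_simp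
      _ ≤ t / m * ((m ^ 2 - r) * (Y' - q')) := by gcongr
      _ = (m ^ 2 - r) * (t / m * (Y' - q')) := by ring
      _ ≤ (m ^ 2 - r) * ((m ^ 2 - r) * (X' - p')) := by
        refine mul_le_mul_of_nonneg_left h1 (by linarith)
      _ = _ := by ring
  have h4 : 0 ≤ X' - p' := by
    have : 0 < (m ^ 2 - r) ^ 2 - t ^ 2 := by nlinarith
    by_contra hneg
    nlinarith
  have h5 : 0 ≤ Y' - q' := by
    have h6 : 0 ≤ (m ^ 2 - r) * (Y' - q') := le_trans (by positivity) h2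
    exact nonneg_of_mul_nonneg_right h6 (by linarith)
  exact ⟨by linarith, by linarith⟩

/-- Induction on `N` by `le_of_step_le`, with `W = -t`: then `-W = t` makes every coefficient
nonnegative, and the odd powers of `W` account for the sign in the second bound. -/
theorem sum_mixSum_le_connectorSum (hr : 0 ≤ r) (ht : 0 ≤ t) (hrt : r + t < 1) (J M N : ℕ) :
    ∑ d ∈ Finset.range (J + 1), t ^ (2 * d) *
        ∑ n ∈ Finset.range (M + 1), mixSum t (2 * d) n N * r ^ n ≤
      connectorSum (altProd r (-t)) N ∧
    ∑ d ∈ Finset.range (J + 1), t ^ (2 * d + 1) *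
        ∑ n ∈ Finset.range (M + 1), mixSum t (2 * d + 1) n N * r ^ n ≤
      -(N * connectorSum (fun k => (-1) ^ k * altProd r (-t) k) N) := by
  have hne : ∀ n : ℕ, ((n : ℝ) + 1) ^ 2 - r - (-1) ^ (n + 1) * (-t) ≠ 0 := by
    intro n
    have h1 : |r| = r := abs_of_nonneg hr
    have h2 : |1 - r| = 1 - r := abs_of_nonneg (by linarith)
    refine sq_sub_ne_zero (𝕜 := ℝ) ?_ ?_ n
    · rw [Real.norm_eq_abs, h1]; linarith
    · rw [norm_neg, Real.norm_eq_abs, Real.norm_eq_abs, h2, abs_of_nonneg ht]; linarith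
  set U : ℕ → ℕ → ℝ := fun j N => ∑ n ∈ Finset.range (M + 1), mixSum t j n N * r ^ n with hU
  have hU0 : ∀ j N, 0 ≤ U j N := fun j N =>
    Finset.sum_nonneg fun n _ => mul_nonneg (mixSum_nonneg ht _ _ _) (by positivity)
  change ∑ d ∈ Finset.range (J + 1), t ^ (2 * d) * U (2 * d) N ≤ _ ∧
    ∑ d ∈ Finset.range (J + 1), t ^ (2 * d + 1) * U (2 * d + 1) N ≤ _
  induction N with
  | zero =>
    have h1 : ∀ j, U (j + 1) 0 = 0 := fun j => by simp [hU, mixSum_succ_zero]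
    have h2 : U 0 0 = 1 := by
      simp only [hU]
      rw [Finset.sum_range_succ']
      simp [mixSum_zero_succ_zero, mixSum_zero_zero_zero]
    constructor
    · rw [Finset.sum_range_succ']
      simp [h1, h2, mul_add, connectorSum, altProd_zero]
    · simp [h1]
  | succ N ih =>
    have hX := connectorSum_altProd_rec hne N
    have hY := mul_connectorSum_altProd_rec hne N
    have hm : (0 : ℝ) < N + 1 := by positivity
    have hA := sum_mixSum_zero_le hr ht M N
    have hB := fun j => sum_mixSum_succ_le hr ht j M N
    refine le_of_step_le (m := N + 1) (by linarith [(Nat.cast_nonneg N : (0 : ℝ) ≤ N)]) ht hrt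
      ?_ ?_ ?_ ?_ ih.1 ih.2
    · have h1 : ∀ d, ((N : ℝ) + 1) ^ 2 * (U (2 * (d + 1)) (N + 1) - U (2 * (d + 1)) N) ≤
          r * U (2 * (d + 1)) (N + 1) + 1 / ((N : ℝ) + 1) * U (2 * d + 1) (N + 1) := by
        intro d
        have h := hB (2 * d + 1)
        rw [if_pos (by omega)] at h
        change U (2 * (d + 1)) (N + 1) ≤ U (2 * (d + 1)) N + r / ((N : ℝ) + 1) ^ 2 *
          U (2 * (d + 1)) (N + 1) + U (2 * d + 1) (N + 1) / ((N : ℝ) + 1) ^ 3 at h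
        have h' := mul_le_mul_of_nonneg_left h (show (0 : ℝ) ≤ ((N : ℝ) + 1) ^ 2 by positivity)
        have e : ((N : ℝ) + 1) ^ 2 * (U (2 * (d + 1)) N + r / ((N : ℝ) + 1) ^ 2 *
          U (2 * (d + 1)) (N + 1) + U (2 * d + 1) (N + 1) / ((N : ℝ) + 1) ^ 3) =
          ((N : ℝ) + 1) ^ 2 * U (2 * (d + 1)) N + r * U (2 * (d + 1)) (N + 1) +
            1 / ((N : ℝ) + 1) * U (2 * d + 1) (N + 1) := by field_simp
        rw [e] at h'
        linarith
      have h0 : ((N : ℝ) + 1) ^ 2 * (U 0 (N + 1) - U 0 N) ≤ r * U 0 (N + 1) + t - r := by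
        change U 0 (N + 1) ≤ U 0 N + r / ((N : ℝ) + 1) ^ 2 * (U 0 (N + 1) - 1) +
          t / ((N : ℝ) + 1) ^ 2 at hA
        have h' := mul_le_mul_of_nonneg_left hA (show (0 : ℝ) ≤ ((N : ℝ) + 1) ^ 2 by positivity)
        have e : ((N : ℝ) + 1) ^ 2 * (U 0 N + r / ((N : ℝ) + 1) ^ 2 * (U 0 (N + 1) - 1) +
          t / ((N : ℝ) + 1) ^ 2) =
          ((N : ℝ) + 1) ^ 2 * U 0 N + r * (U 0 (N + 1) - 1) + t := by field_simp
        rw [e] at h'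
        linarith
      have h2 : ∑ d ∈ Finset.range J, t ^ (2 * (d + 1)) *
            (((N : ℝ) + 1) ^ 2 * (U (2 * (d + 1)) (N + 1) - U (2 * (d + 1)) N)) ≤
          ∑ d ∈ Finset.range J, t ^ (2 * (d + 1)) *
            (r * U (2 * (d + 1)) (N + 1) + 1 / ((N : ℝ) + 1) * U (2 * d + 1) (N + 1)) :=
        Finset.sum_le_sum fun d _ => mul_le_mul_of_nonneg_left (h1 d) (by positivity)
      -- An even string of level `d + 1` comes from an odd one of level `d`, so only `d < J` occurs;
      -- the extra term at `J` is nonnegative.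
      have h3 : ∑ d ∈ Finset.range J, t ^ (2 * d + 1) * U (2 * d + 1) (N + 1) ≤
          ∑ d ∈ Finset.range (J + 1), t ^ (2 * d + 1) * U (2 * d + 1) (N + 1) := by
        rw [Finset.sum_range_succ]
        exact le_add_of_nonneg_right (mul_nonneg (by positivity) (hU0 _ _))
      have h4 := mul_le_mul_of_nonneg_left h3 (show 0 ≤ t / ((N : ℝ) + 1) by positivity)
      rw [Finset.sum_range_succ' (fun d => t ^ (2 * d) * U (2 * d) (N + 1)),
        Finset.sum_range_succ' (fun d => t ^ (2 * d) * U (2 * d) N)]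
      have e1 : ∑ d ∈ Finset.range J, t ^ (2 * (d + 1)) *
            (((N : ℝ) + 1) ^ 2 * (U (2 * (d + 1)) (N + 1) - U (2 * (d + 1)) N)) =
          ((N : ℝ) + 1) ^ 2 * (∑ d ∈ Finset.range J, t ^ (2 * (d + 1)) * U (2 * (d + 1)) (N + 1) -
            ∑ d ∈ Finset.range J, t ^ (2 * (d + 1)) * U (2 * (d + 1)) N) := by
        rw [← Finset.sum_sub_distrib, Finset.mul_sum]
        exact Finset.sum_congr rfl fun d _ => by ring
      have e2 : ∑ d ∈ Finset.range J, t ^ (2 * (d + 1)) *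
            (r * U (2 * (d + 1)) (N + 1) + 1 / ((N : ℝ) + 1) * U (2 * d + 1) (N + 1)) =
          r * ∑ d ∈ Finset.range J, t ^ (2 * (d + 1)) * U (2 * (d + 1)) (N + 1) +
          t / ((N : ℝ) + 1) * ∑ d ∈ Finset.range J, t ^ (2 * d + 1) * U (2 * d + 1) (N + 1) := by
        rw [Finset.mul_sum, Finset.mul_sum, ← Finset.sum_add_distrib]
        exact Finset.sum_congr rfl fun d _ => by ring
      rw [e1, e2] at h2
      simp only [mul_zero, pow_zero, one_mul]
      linarith
    · have h1 : ∀ d, ((N : ℝ) + 1) ^ 2 * (U (2 * d + 1) (N + 1) - U (2 * d + 1) N) ≤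
          r * U (2 * d + 1) (N + 1) + ((N : ℝ) + 1) * U (2 * d) (N + 1) := by
        intro d
        have h := hB (2 * d)
        rw [if_neg (by omega)] at h
        change U (2 * d + 1) (N + 1) ≤ U (2 * d + 1) N + r / ((N : ℝ) + 1) ^ 2 *
          U (2 * d + 1) (N + 1) + U (2 * d) (N + 1) / ((N : ℝ) + 1) ^ 1 at h
        have h' := mul_le_mul_of_nonneg_left h (show (0 : ℝ) ≤ ((N : ℝ) + 1) ^ 2 by positivity)
        have e : ((N : ℝ) + 1) ^ 2 * (U (2 * d + 1) N + r / ((N : ℝ) + 1) ^ 2 *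
          U (2 * d + 1) (N + 1) + U (2 * d) (N + 1) / ((N : ℝ) + 1) ^ 1) =
          ((N : ℝ) + 1) ^ 2 * U (2 * d + 1) N + r * U (2 * d + 1) (N + 1) +
            ((N : ℝ) + 1) * U (2 * d) (N + 1) := by field_simp
        rw [e] at h'
        linarith
      have h2 : ∑ d ∈ Finset.range (J + 1), t ^ (2 * d + 1) *
            (((N : ℝ) + 1) ^ 2 * (U (2 * d + 1) (N + 1) - U (2 * d + 1) N)) ≤
          ∑ d ∈ Finset.range (J + 1), t ^ (2 * d + 1) *
            (r * U (2 * d + 1) (N + 1) + ((N : ℝ) + 1) * U (2 * d) (N + 1)) :=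
        Finset.sum_le_sum fun d _ => mul_le_mul_of_nonneg_left (h1 d) (by positivity)
      rw [← Finset.sum_sub_distrib, Finset.mul_sum, Finset.mul_sum, Finset.mul_sum,
        ← Finset.sum_add_distrib]
      refine le_trans (le_of_eq (Finset.sum_congr rfl fun d _ => by ring))
        (h2.trans (le_of_eq (Finset.sum_congr rfl fun d _ => by ring)))
    · rw [hX]
      push_cast
      field_simp
      ring
    · push_cast
      linear_combination -hY

end PositiveBound

theorem sum_le_of_sum_range_range_le {f : ℕ × ℕ → ℝ} (hf : ∀ x, 0 ≤ f x) {C : ℝ}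
    (h : ∀ J M, ∑ d ∈ Finset.range (J + 1), ∑ n ∈ Finset.range (M + 1), f (d, n) ≤ C)
    (u : Finset (ℕ × ℕ)) : ∑ x ∈ u, f x ≤ C := by
  refine le_trans (Finset.sum_le_sum_of_subset_of_nonneg
    (t := Finset.range (u.sup Prod.fst + 1) ×ˢ Finset.range (u.sup Prod.snd + 1)) ?_
    fun x _ _ => hf x) ?_
  · intro x hx
    simp only [Finset.mem_product, Finset.mem_range, Nat.lt_succ_iff]
    exact ⟨Finset.le_sup (f := Prod.fst) hx, Finset.le_sup (f := Prod.snd) hx⟩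
  · rw [Finset.sum_product]
    exact h _ _

section RealSummability

variable {r t : ℝ}

theorem sum_mixSum_even_le (hr : 0 ≤ r) (ht : 0 ≤ t) (hrt : r + t < 1) (N : ℕ)
    (u : Finset (ℕ × ℕ)) :
    ∑ x ∈ u, mixSum t (2 * x.1) x.2 N * t ^ (2 * x.1) * r ^ x.2 ≤
      connectorSum (altProd r (-t)) N := by
  refine sum_le_of_sum_range_range_le (f := fun x : ℕ × ℕ =>
    mixSum t (2 * x.1) x.2 N * t ^ (2 * x.1) * r ^ x.2)
    (fun x => mul_nonneg (mul_nonneg (mixSum_nonneg ht _ _ _) (by positivity)) (by positivity))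
    (fun J M => ?_) u
  refine le_trans (le_of_eq (Finset.sum_congr rfl fun d _ => ?_))
    (sum_mixSum_le_connectorSum hr ht hrt J M N).1
  rw [Finset.mul_sum]
  exact Finset.sum_congr rfl fun n _ => by ring

theorem summable_mixSum_even (hr : 0 ≤ r) (ht : 0 ≤ t) (hrt : r + t < 1) (N : ℕ) :
    Summable fun x : ℕ × ℕ => mixSum t (2 * x.1) x.2 N * t ^ (2 * x.1) * r ^ x.2 :=
  summable_of_sum_le
    (fun x => mul_nonneg (mul_nonneg (mixSum_nonneg ht _ _ _) (by positivity)) (by positivity))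
    (sum_mixSum_even_le hr ht hrt N)

theorem summable_mixSum_odd (hr : 0 ≤ r) (ht : 0 ≤ t) (hrt : r + t < 1) (N : ℕ) :
    Summable fun x : ℕ × ℕ => mixSum t (2 * x.1 + 1) x.2 N * t ^ (2 * x.1 + 1) * r ^ x.2 := by
  have h0 : ∀ x : ℕ × ℕ, 0 ≤ mixSum t (2 * x.1 + 1) x.2 N * t ^ (2 * x.1 + 1) * r ^ x.2 :=
    fun x => mul_nonneg (mul_nonneg (mixSum_nonneg ht _ _ _) (by positivity)) (by positivity)
  refine summable_of_sum_le h0 (sum_le_of_sum_range_range_le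
    (C := -(N * connectorSum (fun k => (-1) ^ k * altProd r (-t) k) N)) h0 fun J M => ?_)
  refine le_trans (le_of_eq (Finset.sum_congr rfl fun d _ => ?_))
    (sum_mixSum_le_connectorSum hr ht hrt J M N).2
  rw [Finset.mul_sum]
  exact Finset.sum_congr rfl fun n _ => by ring

/-- Strict positivity of `t` allows division by `t ^ j` after restricting the double series to one
`j`. -/
theorem summable_mixSum (hr : 0 ≤ r) (ht : 0 < t) (hrt : r + t < 1) (j N : ℕ) :
    Summable fun n : ℕ => mixSum t j n N * r ^ n := by
  have key : ∀ j : ℕ, (Summable fun n : ℕ => mixSum t j n N * t ^ j * r ^ n) →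
      Summable fun n : ℕ => mixSum t j n N * r ^ n := by
    intro j h
    refine (h.mul_left (t ^ j)⁻¹).congr fun n => ?_
    have : t ^ j ≠ 0 := by positivity
    field_simp
  rcases Nat.even_or_odd' j with ⟨d, rfl | rfl⟩
  · exact key _ ((summable_mixSum_even hr ht.le hrt N).prod_factor d)
  · exact key _ ((summable_mixSum_odd hr ht.le hrt N).prod_factor d)

/-- The bound is uniform in `N` since the transform converges. The odd sums have no such bound here:
odd strings may begin with `1` and then diverge. -/
theorem exists_sum_mixSum_even_le (hr : 0 ≤ r) (ht : 0 ≤ t) (hrt : r + t < 1) :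
    ∃ C : ℝ, ∀ (N : ℕ) (u : Finset (ℕ × ℕ)),
      ∑ x ∈ u, mixSum t (2 * x.1) x.2 N * t ^ (2 * x.1) * r ^ x.2 ≤ C := by
  have h1 : |r| = r := abs_of_nonneg hr
  have h2 : |1 - r| = 1 - r := abs_of_nonneg (by linarith)
  have h := tendsto_connectorSum_altProd (𝕜 := ℝ) (Z := r) (W := -t)
    (by rw [Real.norm_eq_abs, h1]; linarith)
    (by rw [norm_neg, Real.norm_eq_abs, Real.norm_eq_abs, h2, abs_of_nonneg ht]; linarith)
  obtain ⟨C, hC⟩ := h.bddAbove_range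
  exact ⟨C, fun N u => (sum_mixSum_even_le hr ht hrt N u).trans (hC ⟨N, rfl⟩)⟩

end RealSummability

/-! ### Passage from truncations to star values -/

section Limits

theorem exists_mixSum_even_le (d n : ℕ) : ∃ C : ℝ, ∀ N,
    mixSum (1 / 4 : ℝ) (2 * d) n N ≤ C := by
  -- Any fixed positive `r`, `t` with `r + t < 1` would do; a single coefficient is then read off
  -- from the bound.
  obtain ⟨C, hC⟩ := exists_sum_mixSum_even_le (r := 1 / 4) (t := 1 / 4) (by norm_num)
    (by norm_num) (by norm_num)
  refine ⟨C / ((1 / 4) ^ (2 * d) * (1 / 4) ^ n), fun N => ?_⟩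
  rw [le_div_iff₀ (by positivity), ← mul_assoc]
  simpa using hC N {(d, n)}

theorem tendsto_zSum (d n : ℕ) :
    Filter.Tendsto (zSum (2 * d) n) Filter.atTop (nhds (Zstar0 d n)) := by
  obtain ⟨C, hC⟩ := exists_mixSum_even_le d n
  unfold Zstar0 zSum
  refine tendsto_finsetSum _ fun a ha => ?_
  rw [index31_eq_altIndex]
  refine tendsto_starSum (C := C) fun N => le_trans ?_ (hC N)
  have h1 : starSum (altIndex (2 * d) a) N ≤ zSum (2 * d) n N :=
    Finset.single_le_sum (f := fun a => starSum (altIndex (2 * d) a) N)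
      (fun a _ => starSum_nonneg _ _) ha
  exact h1.trans (le_add_of_nonneg_right (mul_nonneg (by norm_num) (zSumTail_nonneg _ _ _)))

theorem tendsto_zSumTail (d n : ℕ) :
    Filter.Tendsto (zSumTail (2 * d) n) Filter.atTop (nhds (Zstar1 d (n + 1))) := by
  obtain ⟨C, hC⟩ := exists_mixSum_even_le d n
  unfold Zstar1 zSumTail
  refine tendsto_finsetSum _ fun a ha => ?_
  rw [index31_eq_altIndex]
  -- The tail family enters `mixSum (1 / 4)` with weight `1/4`.
  refine tendsto_starSum (C := 4 * C) fun N => ?_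
  have h1 := Finset.single_le_sum (f := fun a : Fin (2 * d + 1) → ℕ => starSum
      (altIndex (2 * d) (fun i => a i.castSucc) ++
        List.replicate (a (Fin.last (2 * d)) + 1) 2) N)
      (fun a _ => starSum_nonneg _ _) ha
  have h2 : zSum (2 * d) n N + 1 / 4 * zSumTail (2 * d) n N ≤ C := hC N
  have h3 := zSum_nonneg (2 * d) n N
  refine h1.trans ?_
  change zSumTail (2 * d) n N ≤ _
  linarith

theorem Zstar0_nonneg (d n : ℕ) : 0 ≤ Zstar0 d n :=
  ge_of_tendsto' (tendsto_zSum d n) fun N => zSum_nonneg _ _ N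

theorem Zstar1_nonneg (d n : ℕ) : 0 ≤ Zstar1 d (n + 1) :=
  ge_of_tendsto' (tendsto_zSumTail d n) fun N => zSumTail_nonneg _ _ N

theorem starSum_mono (l : List ℕ) : Monotone (starSum l) := by
  cases l with
  | nil => intro a b _; simp [starSum_nil]
  | cons s l =>
    refine monotone_nat_of_le_succ fun n => ?_
    rw [starSum_cons_succ]
    exact le_add_of_nonneg_right (div_nonneg (starSum_nonneg _ _) (by positivity))

theorem zSum_mono (j n : ℕ) : Monotone (zSum j n) := fun a b h => by
  unfold zSum
  exact Finset.sum_le_sum fun _ _ => starSum_mono _ h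

theorem zSumTail_mono (j n : ℕ) : Monotone (zSumTail j n) := fun a b h => by
  unfold zSumTail
  exact Finset.sum_le_sum fun _ _ => starSum_mono _ h

theorem zSum_le_Zstar0 (d n N : ℕ) : zSum (2 * d) n N ≤ Zstar0 d n :=
  (zSum_mono _ _).ge_of_tendsto (tendsto_zSum d n) N

theorem zSumTail_le_Zstar1 (d n N : ℕ) : zSumTail (2 * d) n N ≤ Zstar1 d (n + 1) :=
  (zSumTail_mono _ _).ge_of_tendsto (tendsto_zSumTail d n) N

theorem summable_Zstar {r t : ℝ} (hr : 0 ≤ r) (ht : 0 ≤ t) (hrt : r + t < 1) :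
    Summable fun x : ℕ × ℕ =>
      (Zstar0 x.1 x.2 + t * Zstar1 x.1 (x.2 + 1)) * t ^ (2 * x.1) * r ^ x.2 := by
  obtain ⟨C, hC⟩ := exists_sum_mixSum_even_le hr ht hrt
  refine summable_of_sum_le (c := C) (fun x => ?_) fun u => ?_
  · have := Zstar0_nonneg x.1 x.2
    have := Zstar1_nonneg x.1 x.2
    simp only [Pi.zero_apply]
    positivity
  · have h : Filter.Tendsto
        (fun N => ∑ x ∈ u, mixSum t (2 * x.1) x.2 N * t ^ (2 * x.1) * r ^ x.2) Filter.atTop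
        (nhds (∑ x ∈ u, (Zstar0 x.1 x.2 + t * Zstar1 x.1 (x.2 + 1)) * t ^ (2 * x.1) * r ^ x.2)) :=
      tendsto_finsetSum u fun x _ =>
        (((tendsto_zSum x.1 x.2).add ((tendsto_zSumTail x.1 x.2).const_mul t)).mul_const
          _).mul_const _
    exact le_of_tendsto' h fun N => hC N u

end Limits

/-! ### Complex generating functions for small parameters -/

section ComplexSums

variable {r t : ℝ} {Z W : ℂ}

theorem norm_mixSum_neg_le (hW : ‖W‖ ≤ t) (j n N : ℕ) : ‖mixSum (-W) j n N‖ ≤ mixSum t j n N := by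
  unfold mixSum
  refine (norm_add_le _ _).trans (add_le_add ?_ ?_)
  · simp [abs_of_nonneg (zSum_nonneg j n N)]
  · rw [norm_mul, norm_neg]
    refine mul_le_mul hW ?_ (norm_nonneg _) ((norm_nonneg W).trans hW)
    simp [abs_of_nonneg (zSumTail_nonneg j n N)]

/-- The generating function in `Z` of the truncated sums with `j` letters `3` and `1`. -/
noncomputable def mixGen (Z W : ℂ) (j N : ℕ) : ℂ := ∑' n : ℕ, mixSum (-W) j n N * Z ^ n

/-- The truncated generating function for an even number of letters `3` and `1`. -/
noncomputable def evenGen (Z W : ℂ) (N : ℕ) : ℂ := ∑' d : ℕ, mixGen Z W (2 * d) N * W ^ (2 * d)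

/-- The truncated generating function for an odd number of letters `3` and `1`. -/
noncomputable def oddGen (Z W : ℂ) (N : ℕ) : ℂ :=
  ∑' d : ℕ, mixGen Z W (2 * d + 1) N * W ^ (2 * d + 1)

theorem summable_mixSum_complex (ht : 0 < t) (hrt : r + t < 1) (hZ : ‖Z‖ ≤ r) (hW : ‖W‖ ≤ t)
    (j N : ℕ) : Summable fun n : ℕ => mixSum (-W) j n N * Z ^ n := by
  refine Summable.of_norm_bounded
    (summable_mixSum ((norm_nonneg Z).trans hZ) ht hrt j N) fun n => ?_
  rw [norm_mul, norm_pow]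
  exact mul_le_mul (norm_mixSum_neg_le hW j n N) (pow_le_pow_left₀ (norm_nonneg _) hZ n)
    (by positivity) (mixSum_nonneg ht.le _ _ _)

theorem norm_mixSum_mul_le (ht : 0 ≤ t) (hZ : ‖Z‖ ≤ r) (hW : ‖W‖ ≤ t) (j n N : ℕ) :
    ‖mixSum (-W) j n N * W ^ j * Z ^ n‖ ≤ mixSum t j n N * t ^ j * r ^ n := by
  rw [norm_mul, norm_mul, norm_pow, norm_pow]
  have h1 := norm_mixSum_neg_le hW j n N
  have h2 := mixSum_nonneg ht j n N
  gcongr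

theorem summable_mixSum_even_complex (ht : 0 ≤ t) (hrt : r + t < 1) (hZ : ‖Z‖ ≤ r)
    (hW : ‖W‖ ≤ t) (N : ℕ) :
    Summable fun x : ℕ × ℕ => mixSum (-W) (2 * x.1) x.2 N * W ^ (2 * x.1) * Z ^ x.2 :=
  Summable.of_norm_bounded (summable_mixSum_even ((norm_nonneg Z).trans hZ) ht hrt N)
    fun _ => norm_mixSum_mul_le ht hZ hW _ _ _

theorem summable_mixSum_odd_complex (ht : 0 ≤ t) (hrt : r + t < 1) (hZ : ‖Z‖ ≤ r)
    (hW : ‖W‖ ≤ t) (N : ℕ) :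
    Summable fun x : ℕ × ℕ => mixSum (-W) (2 * x.1 + 1) x.2 N * W ^ (2 * x.1 + 1) * Z ^ x.2 :=
  Summable.of_norm_bounded (summable_mixSum_odd ((norm_nonneg Z).trans hZ) ht hrt N)
    fun _ => norm_mixSum_mul_le ht hZ hW _ _ _

theorem tsum_mixSum_mul (j N : ℕ) :
    ∑' n : ℕ, mixSum (-W) j n N * W ^ j * Z ^ n = mixGen Z W j N * W ^ j := by
  rw [mixGen, ← tsum_mul_right]
  exact tsum_congr fun n => by ring

theorem summable_mixGen_even (ht : 0 ≤ t) (hrt : r + t < 1) (hZ : ‖Z‖ ≤ r)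
    (hW : ‖W‖ ≤ t) (N : ℕ) : Summable fun d : ℕ => mixGen Z W (2 * d) N * W ^ (2 * d) := by
  have h := (summable_mixSum_even_complex ht hrt hZ hW N).prod
  simpa only [tsum_mixSum_mul] using h

theorem summable_mixGen_odd (ht : 0 ≤ t) (hrt : r + t < 1) (hZ : ‖Z‖ ≤ r)
    (hW : ‖W‖ ≤ t) (N : ℕ) : Summable fun d : ℕ => mixGen Z W (2 * d + 1) N * W ^ (2 * d + 1) := by
  have h := (summable_mixSum_odd_complex ht hrt hZ hW N).prod
  simpa only [tsum_mixSum_mul] using h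

theorem evenGen_eq_tsum (ht : 0 ≤ t) (hrt : r + t < 1) (hZ : ‖Z‖ ≤ r) (hW : ‖W‖ ≤ t) (N : ℕ) :
    evenGen Z W N =
      ∑' x : ℕ × ℕ, mixSum (-W) (2 * x.1) x.2 N * W ^ (2 * x.1) * Z ^ x.2 := by
  rw [(summable_mixSum_even_complex ht hrt hZ hW N).tsum_prod, evenGen]
  exact tsum_congr fun d => (tsum_mixSum_mul _ _).symm

theorem mixGen_succ_succ (ht : 0 < t) (hrt : r + t < 1) (hZ : ‖Z‖ ≤ r) (hW : ‖W‖ ≤ t) (j N : ℕ) :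
    mixGen Z W (j + 1) (N + 1) = mixGen Z W (j + 1) N +
      Z / ((N : ℂ) + 1) ^ 2 * mixGen Z W (j + 1) (N + 1) +
      mixGen Z W j (N + 1) / ((N : ℂ) + 1) ^ (if (j + 1) % 2 = 0 then 3 else 1) := by
  have hs := fun j N => summable_mixSum_complex ht hrt hZ hW j N
  have hs' := fun j N => (summable_nat_add_iff 1).mpr (hs j N)
  conv_lhs => rw [mixGen, (hs _ _).tsum_eq_zero_add]
  conv_rhs =>
    rw [mixGen, (hs _ _).tsum_eq_zero_add, mixGen, mixGen, (hs j (N + 1)).tsum_eq_zero_add,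
      ← tsum_mul_left, add_div, ← tsum_div_const]
  have h : ∀ n, mixSum (-W) (j + 1) (n + 1) (N + 1) * Z ^ (n + 1) =
      mixSum (-W) (j + 1) (n + 1) N * Z ^ (n + 1) +
      Z / ((N : ℂ) + 1) ^ 2 * (mixSum (-W) (j + 1) n (N + 1) * Z ^ n) +
      mixSum (-W) j (n + 1) (N + 1) * Z ^ (n + 1) /
        ((N : ℂ) + 1) ^ (if (j + 1) % 2 = 0 then 3 else 1) := by
    intro n
    rw [mixSum_succ_succ_succ]; ring
  rw [tsum_congr h, (((hs' _ _).add ((hs _ _).mul_left _)).tsum_add ((hs' _ _).div_const _)),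
    ((hs' _ _).tsum_add ((hs _ _).mul_left _)), mixSum_succ_zero_succ]
  ring

theorem mixGen_zero_succ (ht : 0 < t) (hrt : r + t < 1) (hZ : ‖Z‖ ≤ r) (hW : ‖W‖ ≤ t) (N : ℕ) :
    mixGen Z W 0 (N + 1) = mixGen Z W 0 N +
      Z / ((N : ℂ) + 1) ^ 2 * (mixGen Z W 0 (N + 1) - 1) - W / ((N : ℂ) + 1) ^ 2 := by
  have hs := fun j N => summable_mixSum_complex ht hrt hZ hW j N
  have hs' := fun j N => (summable_nat_add_iff 1).mpr (hs j N)
  have h1 : HasSum (fun n : ℕ => (if n = 0 then (1 : ℂ) else 0) * Z ^ n) 1 := by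
    convert hasSum_ite_eq (0 : ℕ) (1 : ℂ) using 2 with n
    split_ifs with h <;> simp [h]
  have h2 : HasSum (fun n : ℕ => (mixSum (-W) 0 n (N + 1) - if n = 0 then 1 else 0) * Z ^ n)
      (mixGen Z W 0 (N + 1) - 1) := by
    simp only [sub_mul]
    exact (hs 0 (N + 1)).hasSum.sub h1
  conv_lhs => rw [mixGen, (hs _ _).tsum_eq_zero_add]
  rw [← h2.tsum_eq]
  conv_rhs => rw [mixGen, (hs _ _).tsum_eq_zero_add, ← tsum_mul_left]
  have h : ∀ n, mixSum (-W) 0 (n + 1) (N + 1) * Z ^ (n + 1) =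
      mixSum (-W) 0 (n + 1) N * Z ^ (n + 1) +
      Z / ((N : ℂ) + 1) ^ 2 *
        ((mixSum (-W) 0 n (N + 1) - if n = 0 then 1 else 0) * Z ^ n) := by
    intro n
    rw [mixSum_zero_succ_succ]; ring
  rw [tsum_congr h, ((hs' _ _).tsum_add (h2.summable.mul_left _)), mixSum_zero_zero_succ]
  ring

theorem evenGen_succ (ht : 0 < t) (hrt : r + t < 1) (hZ : ‖Z‖ ≤ r) (hW : ‖W‖ ≤ t) (N : ℕ) :
    evenGen Z W (N + 1) = evenGen Z W N + Z / ((N : ℂ) + 1) ^ 2 * evenGen Z W (N + 1) +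
      W / ((N : ℂ) + 1) ^ 3 * oddGen Z W (N + 1) - (Z + W) / ((N : ℂ) + 1) ^ 2 := by
  have hs := fun N => summable_mixGen_even ht.le hrt hZ hW N
  have ho := fun N => summable_mixGen_odd ht.le hrt hZ hW N
  have hs' := fun N => (summable_nat_add_iff 1).mpr (hs N)
  have h : ∀ d, mixGen Z W (2 * (d + 1)) (N + 1) * W ^ (2 * (d + 1)) =
      mixGen Z W (2 * (d + 1)) N * W ^ (2 * (d + 1)) +
      Z / ((N : ℂ) + 1) ^ 2 * (mixGen Z W (2 * (d + 1)) (N + 1) * W ^ (2 * (d + 1))) +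
      W / ((N : ℂ) + 1) ^ 3 * (mixGen Z W (2 * d + 1) (N + 1) * W ^ (2 * d + 1)) := by
    intro d
    have := mixGen_succ_succ ht hrt hZ hW (2 * d + 1) N
    rw [if_pos (by omega)] at this
    rw [show 2 * (d + 1) = 2 * d + 1 + 1 by ring]
    linear_combination W ^ (2 * d + 1 + 1) * this
  have h0 := mixGen_zero_succ ht hrt hZ hW N
  have e : ∀ N, evenGen Z W N = mixGen Z W 0 N +
      ∑' d, mixGen Z W (2 * (d + 1)) N * W ^ (2 * (d + 1)) := by
    intro N
    rw [evenGen, (hs N).tsum_eq_zero_add]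
    simp
  have key := tsum_congr (L := SummationFilter.unconditional ℕ) h
  rw [(((hs' _).add ((hs' _).mul_left _)).tsum_add ((ho _).mul_left _)),
    ((hs' _).tsum_add ((hs' _).mul_left _)), tsum_mul_left, tsum_mul_left] at key
  rw [e (N + 1), e N, oddGen]
  linear_combination key + h0

theorem oddGen_succ (ht : 0 < t) (hrt : r + t < 1) (hZ : ‖Z‖ ≤ r) (hW : ‖W‖ ≤ t) (N : ℕ) :
    oddGen Z W (N + 1) = oddGen Z W N + Z / ((N : ℂ) + 1) ^ 2 * oddGen Z W (N + 1) +
      W / ((N : ℂ) + 1) * evenGen Z W (N + 1) := by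
  have hs := fun N => summable_mixGen_even ht.le hrt hZ hW N
  have ho := fun N => summable_mixGen_odd ht.le hrt hZ hW N
  have h : ∀ d, mixGen Z W (2 * d + 1) (N + 1) * W ^ (2 * d + 1) =
      mixGen Z W (2 * d + 1) N * W ^ (2 * d + 1) +
      Z / ((N : ℂ) + 1) ^ 2 * (mixGen Z W (2 * d + 1) (N + 1) * W ^ (2 * d + 1)) +
      W / ((N : ℂ) + 1) * (mixGen Z W (2 * d) (N + 1) * W ^ (2 * d)) := by
    intro d
    have := mixGen_succ_succ ht hrt hZ hW (2 * d) N
    rw [if_neg (by omega)] at this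
    linear_combination W ^ (2 * d + 1) * this
  have key := tsum_congr (L := SummationFilter.unconditional ℕ) h
  rwa [(((ho _).add ((ho _).mul_left _)).tsum_add ((hs _).mul_left _)),
    ((ho _).tsum_add ((ho _).mul_left _)), tsum_mul_left, tsum_mul_left] at key

theorem evenGen_zero (Z W : ℂ) : evenGen Z W 0 = 1 := by
  rw [evenGen, tsum_eq_single 0, mixGen, tsum_eq_single 0]
  · simp [mixSum_zero_zero_zero]
  · intro n hn
    obtain ⟨n, rfl⟩ := Nat.exists_eq_succ_of_ne_zero hn
    simp [mixSum_zero_succ_zero]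
  · intro d hd
    obtain ⟨d, rfl⟩ := Nat.exists_eq_succ_of_ne_zero hd
    simp [mixGen, Nat.mul_succ, mixSum_succ_zero]

theorem oddGen_zero (Z W : ℂ) : oddGen Z W 0 = 0 := by
  simp [oddGen, mixGen, mixSum_succ_zero]

theorem norm_lt_norm_one_sub (hrt : r + t < 1) (hZ : ‖Z‖ ≤ r) (hW : ‖W‖ ≤ t) :
    ‖W‖ < ‖1 - Z‖ := by
  have := norm_sub_norm_le 1 Z
  rw [norm_one] at this
  linarith

/-- Both pairs solve the same linear system with the same start at `N = 0`, and each step determines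
the next pair uniquely. -/
theorem evenGen_eq_connectorSum (ht : 0 < t) (hrt : r + t < 1) (hZ : ‖Z‖ ≤ r) (hW : ‖W‖ ≤ t)
    (N : ℕ) :
    evenGen Z W N = connectorSum (altProd Z W) N ∧
      oddGen Z W N = N * connectorSum (fun k => (-1) ^ k * altProd Z W k) N := by
  have hlt := norm_lt_norm_one_sub hrt hZ hW
  have hZ1 : ‖Z‖ < 1 := by linarith
  have hne := sq_sub_ne_zero hZ1 hlt
  have hne' := sq_sub_ne_zero hZ1 (W := -W) (by rwa [norm_neg])
  induction N with
  | zero => simp [evenGen_zero, oddGen_zero, connectorSum, altProd_zero]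
  | succ N ih =>
    have hX := connectorSum_altProd_rec hne N
    have hY := mul_connectorSum_altProd_rec hne N
    rw [← ih.1] at hX
    rw [← ih.2] at hY
    have hx := evenGen_succ ht hrt hZ hW N
    have hy := oddGen_succ ht hrt hZ hW N
    have hm : (N : ℂ) + 1 ≠ 0 := by exact_mod_cast N.succ_ne_zero
    push_cast
    generalize connectorSum (altProd Z W) (N + 1) = X at *
    generalize connectorSum (fun k => (-1) ^ k * altProd Z W k) (N + 1) = Y at *
    generalize evenGen Z W (N + 1) = x at *
    generalize oddGen Z W (N + 1) = y at *
    generalize evenGen Z W N = x₀ at *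
    generalize oddGen Z W N = y₀ at *
    -- The determinant of one step factors into the denominators of the product at `W` and at `-W`,
    -- both nonzero.
    have hdet : ((((N : ℂ) + 1) ^ 2 - Z) ^ 2 - W ^ 2) ≠ 0 := by
      have : (((N : ℂ) + 1) ^ 2 - Z) ^ 2 - W ^ 2 =
          (((N : ℂ) + 1) ^ 2 - Z - (-1) ^ (N + 1) * W) *
            (((N : ℂ) + 1) ^ 2 - Z - (-1) ^ (N + 1) * -W) := by
        have h1 : ((-1 : ℂ) ^ (N + 1)) ^ 2 = 1 := by rw [← pow_mul, mul_comm, pow_mul]; simp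
        linear_combination W ^ 2 * h1
      rw [this]
      exact mul_ne_zero (hne N) (hne' N)
    generalize (N : ℂ) + 1 = m at *
    have e1 : m * ((m ^ 2 - Z) * (x - X)) = W * (y - m * Y) := by
      field_simp at hx
      linear_combination hx - m * hX
    have e2 : (m ^ 2 - Z) * (y - m * Y) = m * W * (x - X) := by
      field_simp at hy
      linear_combination hy - hY
    have e3 : m * (((m ^ 2 - Z) ^ 2 - W ^ 2) * (x - X)) = 0 := by
      linear_combination (m ^ 2 - Z) * e1 + W * e2
    have e4 : x - X = 0 := by
      rcases mul_eq_zero.mp e3 with h | h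
      · exact absurd h hm
      · exact (mul_eq_zero.mp h).resolve_left hdet
    have e5 : ((m ^ 2 - Z) ^ 2 - W ^ 2) * (y - m * Y) = 0 := by
      linear_combination (m ^ 2 - Z) * e2 + W * e1
    exact ⟨sub_eq_zero.mp e4, sub_eq_zero.mp ((mul_eq_zero.mp e5).resolve_left hdet)⟩

/-- For small parameters the generating function of the `Z⋆₀` and `Z⋆₁` is the infinite product. -/
theorem hasSum_Zstar (ht : 0 < t) (hrt : r + t < 1) (hZ : ‖Z‖ ≤ r) (hW : ‖W‖ ≤ t) :
    HasSum (fun x : ℕ × ℕ => ((Zstar0 x.1 x.2 : ℂ) + -W * (Zstar1 x.1 (x.2 + 1) : ℂ)) *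
      W ^ (2 * x.1) * Z ^ x.2) (altProdLim Z W) := by
  have hr : 0 ≤ r := (norm_nonneg Z).trans hZ
  have hb := summable_Zstar hr ht.le hrt
  have hlt := norm_lt_norm_one_sub hrt hZ hW
  have hlim : Filter.Tendsto (fun N => ∑' x : ℕ × ℕ,
      mixSum (-W) (2 * x.1) x.2 N * W ^ (2 * x.1) * Z ^ x.2) Filter.atTop
      (nhds (∑' x : ℕ × ℕ, ((Zstar0 x.1 x.2 : ℂ) + -W * (Zstar1 x.1 (x.2 + 1) : ℂ)) *
        W ^ (2 * x.1) * Z ^ x.2)) := by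
    -- Truncations increase with `N`, so the series of limits at `(r, t)` dominates all of them.
    refine tendsto_tsum_of_dominated_convergence hb (fun x => ?_)
      (Filter.Eventually.of_forall fun N x => ?_)
    · have h0 := (Complex.continuous_ofReal.tendsto _).comp (tendsto_zSum x.1 x.2)
      have h1 := (Complex.continuous_ofReal.tendsto _).comp (tendsto_zSumTail x.1 x.2)
      exact ((h0.add (h1.const_mul (-W))).mul_const _).mul_const _
    · refine (norm_mixSum_mul_le ht.le hZ hW _ _ _).trans ?_
      have h0 := zSum_le_Zstar0 x.1 x.2 N
      have h1 := zSumTail_le_Zstar1 x.1 x.2 N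
      change (zSum _ _ _ + t * zSumTail _ _ _) * _ * _ ≤ _
      gcongr
  have hsum : Summable (fun x : ℕ × ℕ =>
      ((Zstar0 x.1 x.2 : ℂ) + -W * (Zstar1 x.1 (x.2 + 1) : ℂ)) * W ^ (2 * x.1) * Z ^ x.2) := by
    refine Summable.of_norm_bounded hb fun x => ?_
    have h0 := Zstar0_nonneg x.1 x.2
    have h1 := Zstar1_nonneg x.1 x.2
    have h2 : ‖(Zstar0 x.1 x.2 : ℂ) + -W * (Zstar1 x.1 (x.2 + 1) : ℂ)‖ ≤
        Zstar0 x.1 x.2 + t * Zstar1 x.1 (x.2 + 1) := by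
      refine (norm_add_le _ _).trans ?_
      rw [norm_mul, norm_neg, Complex.norm_real, Complex.norm_real, Real.norm_of_nonneg h0,
        Real.norm_of_nonneg h1]
      gcongr
    rw [norm_mul, norm_mul, norm_pow, norm_pow]
    gcongr
  rw [hsum.hasSum_iff]
  refine tendsto_nhds_unique hlim ?_
  refine (tendsto_connectorSum_altProd (show ‖Z‖ < 1 by linarith) hlt).congr fun N => ?_
  rw [← evenGen_eq_tsum ht.le hrt hZ hW, (evenGen_eq_connectorSum ht hrt hZ hW N).1]

end ComplexSums

/-! ### Evaluation of the product by Euler's formulas -/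

section EulerProducts

/-- `sin (π c / 2) / (π c / 2)`, extended by `1` at `c = 0`. -/
noncomputable def sincHalf (c : ℂ) : ℂ :=
  if c = 0 then 1 else Complex.sin (Real.pi * c / 2) / (Real.pi * c / 2)

theorem tendsto_prod_even (c : ℂ) :
    Filter.Tendsto (fun n : ℕ => ∏ j ∈ Finset.range n, (1 - c ^ 2 / (2 * (j : ℂ) + 2) ^ 2))
      Filter.atTop (nhds (sincHalf c)) := by
  unfold sincHalf
  split_ifs with hc
  · simp [hc]
  · have hpi : (Real.pi : ℂ) ≠ 0 := by exact_mod_cast Real.pi_ne_zero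
    have h := (Complex.tendsto_euler_sin_prod (c / 2)).div_const (Real.pi * c / 2)
    rw [mul_div_assoc] at *
    refine h.congr fun n => ?_
    rw [mul_div_cancel_left₀ _ (by simp [hpi, hc])]
    refine Finset.prod_congr rfl fun j _ => ?_
    have : (j : ℂ) + 1 ≠ 0 := by exact_mod_cast j.succ_ne_zero
    rw [show 2 * (j : ℂ) + 2 = 2 * (j + 1) by ring]
    field_simp

theorem prod_even_mul_prod_odd (c : ℂ) (n : ℕ) :
    (∏ j ∈ Finset.range n, (1 - c ^ 2 / (2 * (j : ℂ) + 2) ^ 2)) *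
      ∏ j ∈ Finset.range n, (1 - c ^ 2 / (2 * (j : ℂ) + 1) ^ 2) =
    ∏ j ∈ Finset.range (2 * n), (1 - (2 * c) ^ 2 / (2 * (j : ℂ) + 2) ^ 2) := by
  have h : ∀ x : ℂ, (2 * c) ^ 2 / (2 * x + 2) ^ 2 = c ^ 2 / (x + 1) ^ 2 := by
    intro x
    rw [show 2 * x + 2 = 2 * (x + 1) by ring, mul_pow, mul_pow]
    exact mul_div_mul_left _ _ (by norm_num)
  simp only [h]
  induction n with
  | zero => simp
  | succ n ih =>
    rw [Finset.prod_range_succ, Finset.prod_range_succ, Nat.mul_succ, Finset.prod_range_succ,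
      Finset.prod_range_succ, ← ih]
    push_cast
    rw [show (2 : ℂ) * n + 1 + 1 = 2 * n + 2 by ring]
    ring

theorem sincHalf_two_mul (c : ℂ) :
    sincHalf (2 * c) = sincHalf c * Complex.cos (Real.pi * c / 2) := by
  unfold sincHalf
  by_cases hc : c = 0
  · simp [hc]
  · have hpi : (Real.pi : ℂ) ≠ 0 := by exact_mod_cast Real.pi_ne_zero
    rw [if_neg (by simpa using hc), if_neg hc,
      show (Real.pi : ℂ) * (2 * c) / 2 = 2 * (Real.pi * c / 2) by ring, Complex.sin_two_mul]
    field_simp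

/-- The odd product is the quotient of the even products at `2c` and `c`, so the double-angle
formula for sine gives the cosine. -/
theorem tendsto_prod_odd {c : ℂ} (hc : sincHalf c ≠ 0) :
    Filter.Tendsto (fun n : ℕ => ∏ j ∈ Finset.range n, (1 - c ^ 2 / (2 * (j : ℂ) + 1) ^ 2))
      Filter.atTop (nhds (Complex.cos (Real.pi * c / 2))) := by
  have h1 := tendsto_prod_even c
  have h2 := (tendsto_prod_even (2 * c)).comp
    (Filter.tendsto_id.const_mul_atTop' (r := 2) two_pos)
  have h3 := h2.div h1 hc
  rw [sincHalf_two_mul, mul_div_cancel_left₀ _ hc] at h3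
  refine h3.congr' ?_
  filter_upwards [h1.eventually_ne hc] with n hn
  simp only [Pi.div_apply, Function.comp_apply, id]
  rw [← prod_even_mul_prod_odd, mul_div_cancel_left₀ _ hn]

theorem tanQuot_eq (a : ℂ) :
    tanQuot a = Real.pi / 2 * (sincHalf a / Complex.cos (Real.pi * a / 2)) := by
  unfold tanQuot sincHalf
  by_cases ha : a = 0
  · simp [ha]
  · have hpi : (Real.pi : ℂ) ≠ 0 := by exact_mod_cast Real.pi_ne_zero
    rw [if_neg ha, if_neg ha, Complex.tan_eq_sin_div_cos]
    field_simp

theorem cotProd_eq (b : ℂ) :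
    cotProd b = 2 / Real.pi * (Complex.cos (Real.pi * b / 2) / sincHalf b) := by
  unfold cotProd sincHalf
  by_cases hb : b = 0
  · simp [hb]
  · have hpi : (Real.pi : ℂ) ≠ 0 := by exact_mod_cast Real.pi_ne_zero
    rw [if_neg hb, if_neg hb, Complex.cot_eq_cos_div_sin]
    field_simp

theorem sincHalf_ne_zero {c : ℂ} (hc : ‖c ^ 2‖ < 2) : sincHalf c ≠ 0 := by
  unfold sincHalf
  split_ifs with h0
  · exact one_ne_zero
  · have hpi : (Real.pi : ℂ) ≠ 0 := by exact_mod_cast Real.pi_ne_zero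
    refine div_ne_zero (fun hs => ?_) (by simp [hpi, h0])
    obtain ⟨k, hk⟩ := Complex.sin_eq_zero_iff.mp hs
    have hck : c = ((2 * k : ℤ) : ℂ) := by
      push_cast
      field_simp at hk
      linear_combination hk
    have hk0 : k ≠ 0 := by rintro rfl; exact h0 (by simpa using hck)
    have h2 : ‖c ^ 2‖ = ((((2 * k) ^ 2 : ℤ)) : ℝ) := by
      rw [hck, ← Int.cast_pow, Complex.norm_intCast, abs_of_nonneg (by positivity)]
    rw [h2] at hc
    have h3 : (2 * k) ^ 2 < 2 := by exact_mod_cast hc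
    have : 0 < k ^ 2 := by positivity
    nlinarith

/-- The zeros are the odd integers, and only `±1` have square of norm below `2`. -/
theorem cos_ne_zero_of_sq_ne_one {c : ℂ} (hc : ‖c ^ 2‖ < 2) (h1 : c ^ 2 ≠ 1) :
    Complex.cos (Real.pi * c / 2) ≠ 0 := by
  intro hs
  obtain ⟨k, hk⟩ := Complex.cos_eq_zero_iff.mp hs
  have hpi : (Real.pi : ℂ) ≠ 0 := by exact_mod_cast Real.pi_ne_zero
  have hck : c = ((2 * k + 1 : ℤ) : ℂ) := by
    push_cast
    field_simp at hk
    linear_combination hk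
  have h2 : ‖c ^ 2‖ = ((((2 * k + 1) ^ 2 : ℤ)) : ℝ) := by
    rw [hck, ← Int.cast_pow, Complex.norm_intCast, abs_of_nonneg (by positivity)]
  rw [h2] at hc
  have h3 : (2 * k + 1) ^ 2 < 2 := by exact_mod_cast hc
  have h4 : k = 0 ∨ k = -1 := by
    have : -2 < k := by nlinarith
    have : k < 1 := by nlinarith
    omega
  rcases h4 with rfl | rfl <;> exact h1 (by rw [hck]; norm_num)

theorem altProd_two_mul {Z W a b : ℂ} (ha : a ^ 2 = Z - W) (hb : b ^ 2 = Z + W) (n : ℕ) :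
    altProd Z W (2 * n) =
      (∏ j ∈ Finset.range n, (1 - a ^ 2 / (2 * (j : ℂ) + 2) ^ 2)) /
        (∏ j ∈ Finset.range n, (1 - a ^ 2 / (2 * (j : ℂ) + 1) ^ 2)) *
      ((∏ j ∈ Finset.range n, (1 - b ^ 2 / (2 * (j : ℂ) + 1) ^ 2)) /
        (∏ j ∈ Finset.range n, (1 - b ^ 2 / (2 * (j : ℂ) + 2) ^ 2))) := by
  induction n with
  | zero => simp [altProd_zero]
  | succ n ih =>
    have h1 : (2 * (n : ℂ) + 1) ^ 2 ≠ 0 := by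
      exact_mod_cast pow_ne_zero 2 (2 * n).succ_ne_zero
    have h2 : (2 * (n : ℂ) + 2) ^ 2 ≠ 0 := by
      exact_mod_cast pow_ne_zero 2 (2 * n + 1).succ_ne_zero
    have e : ∀ x m : ℂ, m ≠ 0 → 1 - x / m = (m - x) / m := fun x m hm => by
      rw [sub_div, div_self hm]
    have hstep : altProd Z W (2 * (n + 1)) = altProd Z W (2 * n) *
        ((((2 * (n : ℂ) + 1) ^ 2 - b ^ 2) / ((2 * (n : ℂ) + 1) ^ 2 - a ^ 2)) *
        (((2 * (n : ℂ) + 2) ^ 2 - a ^ 2) / ((2 * (n : ℂ) + 2) ^ 2 - b ^ 2))) := by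
      rw [Nat.mul_succ, altProd, Finset.prod_range_succ, Finset.prod_range_succ, ← altProd, ha, hb,
        mul_assoc]
      have e1 : (-1 : ℂ) ^ (2 * n + 1) = -1 := by rw [pow_succ, pow_mul]; simp
      have e2 : (-1 : ℂ) ^ (2 * n + 1 + 1) = 1 := by rw [pow_succ, e1]; simp
      rw [e1, e2]
      push_cast
      congr 3 <;> ring
    rw [hstep, ih]
    simp only [Finset.prod_range_succ]
    rw [e _ _ h1, e _ _ h1, e _ _ h2, e _ _ h2]
    have hq : ∀ x y m : ℂ, m ≠ 0 → x / y = (x / m) / (y / m) := fun x y m hm => by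
      rw [div_div_div_cancel_right₀ hm]
    rw [hq _ _ _ h1, hq ((2 * (n : ℂ) + 2) ^ 2 - a ^ 2) _ _ h2]
    simp only [div_eq_mul_inv, mul_inv]
    ring

/-- The infinite product in closed form. -/
theorem altProdLim_eq {Z W a b : ℂ} (hZ : ‖Z‖ < 1) (hW : ‖W‖ < 1) (hWZ : ‖W‖ < ‖1 - Z‖)
    (ha : a ^ 2 = Z - W) (hb : b ^ 2 = Z + W) : altProdLim Z W = tanQuot a * cotProd b := by
  have ha2 : ‖a ^ 2‖ < 2 := by
    rw [ha]; exact (norm_sub_le _ _).trans_lt (by linarith)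
  have hb2 : ‖b ^ 2‖ < 2 := by
    rw [hb]; exact (norm_add_le _ _).trans_lt (by linarith)
  -- `a² = 1` would mean `1 - Z = -W`, the boundary case of `hWZ`. Nothing similar is needed for
  -- `b`, whose cosine is in the numerator.
  have ha1 : a ^ 2 ≠ 1 := by
    intro h
    rw [ha] at h
    rw [show 1 - Z = -W by rw [← h]; ring, norm_neg] at hWZ
    exact lt_irrefl _ hWZ
  have hpi : (Real.pi : ℂ) ≠ 0 := by exact_mod_cast Real.pi_ne_zero
  have hsa := sincHalf_ne_zero ha2
  have hsb := sincHalf_ne_zero hb2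
  have hlim := ((tendsto_prod_even a).div (tendsto_prod_odd hsa)
    (cos_ne_zero_of_sq_ne_one ha2 ha1)).mul
    ((tendsto_prod_odd hsb).div (tendsto_prod_even b) hsb)
  have h2 := (tendsto_altProd hZ hWZ).comp
    (Filter.tendsto_id.const_mul_atTop' (r := 2) two_pos)
  rw [tendsto_nhds_unique h2 (hlim.congr fun n => (altProd_two_mul ha hb n).symm),
    tanQuot_eq, cotProd_eq]
  field_simp

end EulerProducts

/-! ### Power series in `W` and extension to the full disc -/

section Assembly

variable {Z : ℂ}

theorem summable_Zstar0_mul_pow (hZ : ‖Z‖ < 1) (d : ℕ) :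
    Summable fun n : ℕ => (Zstar0 d n : ℂ) * Z ^ n := by
  -- An auxiliary `t > 0` with `‖Z‖ + t < 1`; its power is divided out, so the result holds whatever
  -- the size of `W`.
  have ht : 0 < (1 - ‖Z‖) / 2 := by linarith
  have h := ((summable_Zstar (norm_nonneg Z) ht.le (by linarith)).prod_factor d).mul_left
    (((1 - ‖Z‖) / 2) ^ (2 * d))⁻¹
  refine Summable.of_norm_bounded h fun n => ?_
  have h0 := Zstar0_nonneg d n
  have h1 := Zstar1_nonneg d n
  rw [norm_mul, norm_pow, Complex.norm_real, Real.norm_of_nonneg h0, inv_mul_eq_div,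
    le_div_iff₀ (by positivity)]
  generalize (1 - ‖Z‖) / 2 = t at *
  have : 0 ≤ t * Zstar1 d (n + 1) * t ^ (2 * d) * ‖Z‖ ^ n := by positivity
  simp only
  linarith

theorem summable_Zstar1_mul_pow (hZ : ‖Z‖ < 1) (d : ℕ) :
    Summable fun n : ℕ => (Zstar1 d (n + 1) : ℂ) * Z ^ n := by
  have ht : 0 < (1 - ‖Z‖) / 2 := by linarith
  have h := ((summable_Zstar (norm_nonneg Z) ht.le (by linarith)).prod_factor d).mul_left
    (((1 - ‖Z‖) / 2) ^ (2 * d + 1))⁻¹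
  refine Summable.of_norm_bounded h fun n => ?_
  have h0 := Zstar0_nonneg d n
  have h1 := Zstar1_nonneg d n
  rw [norm_mul, norm_pow, Complex.norm_real, Real.norm_of_nonneg h1, inv_mul_eq_div,
    le_div_iff₀ (by positivity)]
  generalize (1 - ‖Z‖) / 2 = t at *
  have : 0 ≤ Zstar0 d n * t ^ (2 * d) * ‖Z‖ ^ n := by positivity
  simp only [pow_succ]
  nlinarith

/-- The coefficients of the generating function as a power series in `W`. -/
noncomputable def genCoeff (Z : ℂ) (m : ℕ) : ℂ :=
  if m % 2 = 0 then ∑' n : ℕ, (Zstar0 (m / 2) n : ℂ) * Z ^ n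
  else -∑' n : ℕ, (Zstar1 (m / 2) (n + 1) : ℂ) * Z ^ n

theorem genCoeff_even (Z : ℂ) (d : ℕ) :
    genCoeff Z (2 * d) = ∑' n : ℕ, (Zstar0 d n : ℂ) * Z ^ n := by
  simp [genCoeff]

theorem genCoeff_odd (Z : ℂ) (d : ℕ) :
    genCoeff Z (2 * d + 1) = -∑' n : ℕ, (Zstar1 d (n + 1) : ℂ) * Z ^ n := by
  rw [genCoeff, if_neg (by omega), show (2 * d + 1) / 2 = d by omega]

theorem hasSum_genCoeff_of_small (hZ : ‖Z‖ < 1) {W : ℂ} (hW : ‖W‖ ≤ (1 - ‖Z‖) / 2) :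
    HasSum (fun m : ℕ => genCoeff Z m * W ^ m) (altProdLim Z W) := by
  have ht : 0 < (1 - ‖Z‖) / 2 := by linarith
  have hrt : ‖Z‖ + (1 - ‖Z‖) / 2 < 1 := by linarith
  have hb := summable_Zstar (norm_nonneg Z) ht.le hrt
  have hS := hasSum_Zstar ht hrt le_rfl hW
  generalize (1 - ‖Z‖) / 2 = t at *
  have p0 : Summable fun x : ℕ × ℕ => (Zstar0 x.1 x.2 : ℂ) * W ^ (2 * x.1) * Z ^ x.2 := by
    refine Summable.of_norm_bounded hb fun x => ?_
    have h0 := Zstar0_nonneg x.1 x.2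
    have h1 := Zstar1_nonneg x.1 x.2
    rw [norm_mul, norm_mul, norm_pow, norm_pow, Complex.norm_real, Real.norm_of_nonneg h0]
    gcongr
    exact le_add_of_nonneg_right (by positivity)
  have p1 : Summable fun x : ℕ × ℕ =>
      -((Zstar1 x.1 (x.2 + 1) : ℂ) * W ^ (2 * x.1 + 1) * Z ^ x.2) := by
    refine (hS.summable.sub p0).congr fun x => ?_
    ring
  have q0 : HasSum (fun d : ℕ => genCoeff Z (2 * d) * W ^ (2 * d)) (∑' x : ℕ × ℕ,
      (Zstar0 x.1 x.2 : ℂ) * W ^ (2 * x.1) * Z ^ x.2) := by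
    refine p0.hasSum.prod_fiberwise fun d => ?_
    rw [genCoeff_even]
    have := (summable_Zstar0_mul_pow hZ d).hasSum.mul_right (W ^ (2 * d))
    simpa only [mul_right_comm] using this
  have q1 : HasSum (fun d : ℕ => genCoeff Z (2 * d + 1) * W ^ (2 * d + 1)) (∑' x : ℕ × ℕ,
      -((Zstar1 x.1 (x.2 + 1) : ℂ) * W ^ (2 * x.1 + 1) * Z ^ x.2)) := by
    refine p1.hasSum.prod_fiberwise fun d => ?_
    rw [genCoeff_odd, neg_mul]
    have := ((summable_Zstar1_mul_pow hZ d).hasSum.mul_right (W ^ (2 * d + 1))).neg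
    simpa only [mul_right_comm] using this
  have h := HasSum.even_add_odd (f := fun m : ℕ => genCoeff Z m * W ^ m) q0 q1
  have hS' := p0.hasSum.add p1.hasSum
  rw [hS.unique (by convert hS' using 2 with x; ring)]
  exact h

/-- Near `0` the coefficients `genCoeff Z` sum to `altProdLim Z`, so they are its Taylor
coefficients; Cauchy's theorem makes the Taylor series converge on any disc inside the domain of
holomorphy. -/
theorem hasSum_genCoeff (hZ : ‖Z‖ < 1) {W : ℂ} (hW : ‖W‖ < ‖1 - Z‖) :
    HasSum (fun m : ℕ => genCoeff Z m * W ^ m) (altProdLim Z W) := by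
  -- Two radii: holomorphy holds on the open ball of radius `R'`, while the Cauchy expansion needs a
  -- closed ball, of radius `R < R'`, with `W` in its interior.
  obtain ⟨R', hR1, hR2⟩ := exists_between hW
  obtain ⟨R, hWR, hR3⟩ := exists_between hR1
  have hR0 : 0 < R := (norm_nonneg W).trans_lt hWR
  have ht : 0 < (1 - ‖Z‖) / 2 := by linarith
  have hp : HasFPowerSeriesAt (altProdLim Z)
      (FormalMultilinearSeries.ofScalars ℂ (genCoeff Z)) 0 := by
    rw [hasFPowerSeriesAt_iff]
    filter_upwards [Metric.closedBall_mem_nhds (0 : ℂ) ht] with V hV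
    rw [zero_add]
    simpa [mul_comm] using hasSum_genCoeff_of_small hZ (mem_closedBall_zero_iff.mp hV)
  lift R to NNReal using hR0.le
  have hq := ((differentiableOn_altProdLim hZ hR2).mono
    (Metric.closedBall_subset_ball hR3)).hasFPowerSeriesOnBall (by exact_mod_cast hR0)
  have heq := hq.hasFPowerSeriesAt.eq_formalMultilinearSeries hp
  rw [heq] at hq
  have := hq.hasSum (y := W) (by
    rw [Metric.eball_coe, mem_ball_zero_iff]
    exact hWR)
  simpa [FormalMultilinearSeries.apply_eq_pow_smul_coeff, mul_comm] using this

end Assembly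

theorem theorem4p3 (z w : ℂ) (hz : ‖z‖ < 1) (hw : ‖w‖ < 1) :
    (∀ d : ℕ, Summable fun n : ℕ => (Zstar0 d n : ℂ) * z ^ (2 * n) * w ^ (4 * d)) ∧
    (∀ d : ℕ, Summable fun n : ℕ => (Zstar1 d (n + 1) : ℂ) * z ^ (2 * n) * w ^ (4 * d + 2)) ∧
    (‖w‖ ^ 2 < ‖1 - z ^ 2‖ →
      (Summable fun d : ℕ => ∑' n : ℕ, (Zstar0 d n : ℂ) * z ^ (2 * n) * w ^ (4 * d)) ∧
      (Summable fun d : ℕ => ∑' n : ℕ, (Zstar1 d (n + 1) : ℂ) * z ^ (2 * n) * w ^ (4 * d + 2)) ∧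
      ∀ a b : ℂ, a ^ 2 = z ^ 2 - w ^ 2 → b ^ 2 = z ^ 2 + w ^ 2 →
        (∑' d : ℕ, ∑' n : ℕ, (Zstar0 d n : ℂ) * z ^ (2 * n) * w ^ (4 * d)) -
          (∑' d : ℕ, ∑' n : ℕ, (Zstar1 d (n + 1) : ℂ) * z ^ (2 * n) * w ^ (4 * d + 2)) =
        tanQuot a * cotProd b) := by
  have hZ : ‖z ^ 2‖ < 1 := by rw [norm_pow]; exact pow_lt_one₀ (norm_nonneg _) hz two_ne_zero
  have hW : ‖w ^ 2‖ < 1 := by rw [norm_pow]; exact pow_lt_one₀ (norm_nonneg _) hw two_ne_zero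
  have e0 : ∀ d : ℕ, w ^ (4 * d) = (w ^ 2) ^ (2 * d) := fun d => by rw [← pow_mul]; congr 1; ring
  have e1 : ∀ d : ℕ, w ^ (4 * d + 2) = (w ^ 2) ^ (2 * d + 1) := fun d => by
    rw [← pow_mul]; congr 1; ring
  simp only [pow_mul z, e0, e1]
  refine ⟨fun d => (summable_Zstar0_mul_pow hZ d).mul_right _,
    fun d => (summable_Zstar1_mul_pow hZ d).mul_right _, fun hlt => ?_⟩
  rw [← norm_pow] at hlt
  have h := hasSum_genCoeff hZ hlt
  have t0 : ∀ d : ℕ, ∑' n : ℕ, (Zstar0 d n : ℂ) * (z ^ 2) ^ n * (w ^ 2) ^ (2 * d) =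
      genCoeff (z ^ 2) (2 * d) * (w ^ 2) ^ (2 * d) := fun d => by
    rw [tsum_mul_right, genCoeff_even]
  have t1 : ∀ d : ℕ, ∑' n : ℕ, (Zstar1 d (n + 1) : ℂ) * (z ^ 2) ^ n * (w ^ 2) ^ (2 * d + 1) =
      -(genCoeff (z ^ 2) (2 * d + 1) * (w ^ 2) ^ (2 * d + 1)) := fun d => by
    rw [tsum_mul_right, genCoeff_odd, neg_mul, neg_neg]
  have s0 : Summable fun d : ℕ => genCoeff (z ^ 2) (2 * d) * (w ^ 2) ^ (2 * d) :=
    h.summable.comp_injective (i := fun d : ℕ => 2 * d) fun a b hab => by simpa using hab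
  have s1 : Summable fun d : ℕ => genCoeff (z ^ 2) (2 * d + 1) * (w ^ 2) ^ (2 * d + 1) :=
    h.summable.comp_injective (i := fun d : ℕ => 2 * d + 1) fun a b hab => by simpa using hab
  simp only [t0, t1]
  refine ⟨s0, s1.neg, fun a b ha hb => ?_⟩
  rw [tsum_neg, sub_neg_eq_add, ← altProdLim_eq hZ hW hlt ha hb, ← h.tsum_eq]
  exact tsum_even_add_odd (f := fun m : ℕ => genCoeff (z ^ 2) m * (w ^ 2) ^ m) s0 s1
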